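/- Let $n\ge 3$, let $\mathbb{B}^n$ be the open unit ball of $\mathbb{R}^n$ with the Euclidean norm $|\cdot|$. A function $u\in C^2(\mathbb{B}^n,\mathbb{R})$ is called harmonic if $\Delta u=0$ on $\mathbb{B}^n$, and hyperbolic harmonic if $$(1-|x|^2)^2\,\Delta u(x)+2(n-2)(1-|x|^2)\sum_{i=1}^n x_i\frac{\partial u}{\partial x_i}(x)=0\qquad\text{for all }x\in\mathbb{B}^n .$$ Let $h:\mathbb{B}^n\to(-1,1)$. 1. If $h$ is harmonic, then $|\nabla h(0)|\le \frac n2\,(1-|h(0)|^2)$. 2. If $h$ is hyperbolic harmonic, then $|\nabla h(0)|\le (n-1)\,(1-|h(0)|^2)$. If $n\ge 4$, both inequalities are strict for every such $h$. For every $n\ge 3$ the constants are sharp: for every real $c<\frac n2$ there is a harmonic $h:\mathbb{B}^n\to(-1,1)$ with $|\nabla h(0)|>c\,(1-|h(0)|^2)$, and for every real $c<n-1$ there is a hyperbolic harmonic $h:\mathbb{B}^n\to(-1,1)$ with $|\nabla h(0)|>c\,(1-|h(0)|^2)$. -/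

import Mathlib

/-- The open unit ball of `ℝⁿ` with the Euclidean norm. -/
def unitBall (n : ℕ) : Set (EuclideanSpace ℝ (Fin n)) := Metric.ball 0 1

/-- The hyperbolic Laplacian
`Δ_h u(x) = (1 - |x|²)² Δu(x) + 2 (n - 2) (1 - |x|²) ∑ᵢ xᵢ ∂u/∂xᵢ(x)`. -/
noncomputable def hyperbolicLaplacian {n : ℕ} (u : EuclideanSpace ℝ (Fin n) → ℝ)
    (x : EuclideanSpace ℝ (Fin n)) : ℝ :=
  (1 - ‖x‖ ^ 2) ^ 2 * Laplacian.laplacian u x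
    + 2 * ((n : ℝ) - 2) * (1 - ‖x‖ ^ 2) *
      ∑ i : Fin n, x i * fderiv ℝ u x (EuclideanSpace.single i (1 : ℝ))

/-- `u` is `C²` and hyperbolic harmonic on the open unit ball (the values of `u` outside the ball
play no role). -/
def IsHyperbolicHarmonic {n : ℕ} (u : EuclideanSpace ℝ (Fin n) → ℝ) : Prop :=
  ContDiffOn ℝ 2 u (unitBall n) ∧ ∀ x ∈ unitBall n, hyperbolicLaplacian u x = 0

/-- `u` is `C²` and harmonic on the open unit ball (the values of `u` outside the ball
play no role). -/
def IsHarmonic {n : ℕ} (u : EuclideanSpace ℝ (Fin n) → ℝ) : Prop :=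
  InnerProductSpace.HarmonicOnNhd u (unitBall n)

/-!
Both equations have the form `(1 - |x|²) Δh + 2 β x · ∇h = 0`, with `β = 0` or `β = n - 2`. The
spherical means of a solution satisfy a linear ODE which makes them constant, equal to `h 0`, and
an ODE for the first moments `m(r) = ∫ ⟨e, ζ⟩ h(rζ) dσ(ζ)` gives `r ∂ₑh(0) = n m(r)` in the harmonic
case and `r ∂ₑh(0) ≤ 2 (n - 1) m(r)` in the hyperbolic one. Since `|h| ≤ 1` has mean `h 0` on each
sphere, the bathtub principle yields `m(r) ≤ ∫ |⟨e, ζ⟩ + h 0| dσ(ζ) - h(0)²`. For `n = 3` the height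
`⟨e, ζ⟩` is uniform on `[-1, 1]` by Archimedes' theorem and the right-hand side is
`(1 - h(0)²) / 2`. In general, Stein's equation for the uniform law shows that it differs from this
value by `n - 3` times a negative number.

The extremals degenerate to the constant `-1`: for `h = -1 + b u` with `u > 0` bounded and `b → 0`,
sharpness asks for `|∇u(0)| / u(0)` close to `n`, resp. `2 (n - 1)`. In the harmonic case Poisson
kernels with a pole just outside the ball do this, in the other one the hyperbolic harmonic measures
of shrinking spherical caps, which are functions of the signed hyperbolic distance to the hyperplane
that bounds the cap at infinity.
-/

open MeasureTheory Metric Set Filter Topology InnerProductSpace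

section CompactSpace

variable {X : Type*} [TopologicalSpace X] [CompactSpace X] [MeasurableSpace X]
  [OpensMeasurableSpace X] {μ : Measure X} [IsFiniteMeasure μ]
  {G : Type*} [NormedAddCommGroup G]

theorem integrable_of_continuous_of_compactSpace {f : X → G} (hf : Continuous f) :
    Integrable f μ :=
  hf.integrable_of_hasCompactSupport (HasCompactSupport.of_compactSpace f)

variable [NormedSpace ℝ G]

theorem hasDerivAt_integral_of_compactSpace {g g' : ℝ → X → G} {s : Set ℝ} (hs : IsOpen s)
    (hg : ∀ r ∈ s, Continuous (g r)) (hgg' : ∀ r ∈ s, ∀ x, HasDerivAt (g · x) (g' r x) r)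
    (hg' : ContinuousOn (fun p : ℝ × X => g' p.1 p.2) (s ×ˢ univ)) {r : ℝ} (hr : r ∈ s) :
    HasDerivAt (fun t => ∫ x, g t x ∂μ) (∫ x, g' r x ∂μ) r := by
  obtain ⟨ε, hε, hεs⟩ := nhds_basis_closedBall.mem_iff.1 (hs.mem_nhds hr)
  obtain ⟨C, hC⟩ := ((isCompact_closedBall r ε).prod isCompact_univ).exists_bound_of_continuousOn
    (hg'.mono (prod_mono hεs Subset.rfl))
  have hg'r : Continuous (g' r) :=
    hg'.comp_continuous (by fun_prop : Continuous fun x : X => (r, x)) fun _ => ⟨hr, mem_univ _⟩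
  refine (hasDerivAt_integral_of_dominated_loc_of_deriv_le (bound := fun _ => C)
    (closedBall_mem_nhds r hε) ?_ (integrable_of_continuous_of_compactSpace (hg r hr))
    (integrable_of_continuous_of_compactSpace hg'r).aestronglyMeasurable
    (.of_forall fun x t ht => hC (t, x) ⟨ht, mem_univ _⟩) (integrable_const _)
    (.of_forall fun x t ht => hgg' t (hεs ht) x)).2
  filter_upwards [hs.mem_nhds hr] with t ht
  exact (integrable_of_continuous_of_compactSpace (hg t ht)).aestronglyMeasurable

end CompactSpace

section SphereMeasure

variable {E : Type*} [NormedAddCommGroup E] [InnerProductSpace ℝ E]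

/-- The homeomorphism of the unit sphere induced by a linear isometry. -/
def sphereHomeomorph (L : E ≃ₗᵢ[ℝ] E) : sphere (0 : E) 1 ≃ₜ sphere (0 : E) 1 where
  toFun ζ := ⟨L ζ, by simp⟩
  invFun ζ := ⟨L.symm ζ, by simp⟩
  left_inv ζ := by simp
  right_inv ζ := by simp
  continuous_toFun := by fun_prop
  continuous_invFun := by fun_prop

open scoped Pointwise in
theorem Ioo_smul_image_preimage_sphereHomeomorph (L : E ≃ₗᵢ[ℝ] E) (s : Set (sphere (0 : E) 1)) :
    Ioo (0 : ℝ) 1 • ((↑) '' (sphereHomeomorph L ⁻¹' s) : Set E) =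
      L ⁻¹' (Ioo (0 : ℝ) 1 • ((↑) '' s)) := by
  ext x
  simp only [Set.mem_smul, Set.mem_image, mem_preimage]
  constructor
  · rintro ⟨r, hr, _, ⟨ζ, hζ, rfl⟩, rfl⟩
    exact ⟨r, hr, L ζ, ⟨_, hζ, rfl⟩, (map_smul L r (ζ : E)).symm⟩
  · rintro ⟨r, hr, _, ⟨ζ, hζ, rfl⟩, hx⟩
    refine ⟨r, hr, L.symm ζ, ⟨(sphereHomeomorph L).symm ζ, by simpa using hζ, rfl⟩, ?_⟩
    rw [← map_smul, hx, L.symm_apply_apply]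

variable [FiniteDimensional ℝ E] [MeasurableSpace E] [BorelSpace E]

variable (E) in
/-- The rotation invariant probability measure on the unit sphere of `E`: Mathlib's surface
measure, normalized to total mass one. -/
noncomputable def sphereMeasure : Measure (sphere (0 : E) 1) :=
  ((volume : Measure E).toSphere univ)⁻¹ • (volume : Measure E).toSphere

instance [Nontrivial E] : IsProbabilityMeasure (sphereMeasure E) where
  measure_univ := by
    rw [sphereMeasure, Measure.smul_apply, smul_eq_mul]
    refine ENNReal.inv_mul_cancel ?_ (measure_ne_top _ _)
    rw [Ne, Measure.measure_univ_eq_zero]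
    exact Measure.toSphere_ne_zero (volume : Measure E)

instance : (sphereMeasure E).IsOpenPosMeasure :=
  Measure.isOpenPosMeasure_smul _ (ENNReal.inv_ne_zero.2 (measure_ne_top _ _))

theorem measurePreserving_sphereHomeomorph (L : E ≃ₗᵢ[ℝ] E) :
    MeasurePreserving (sphereHomeomorph L) (sphereMeasure E) (sphereMeasure E) := by
  have hmeas : Measurable (sphereHomeomorph L) := (sphereHomeomorph L).continuous.measurable
  refine ⟨hmeas, Measure.ext fun s hs => ?_⟩
  rw [Measure.map_apply hmeas hs]
  simp only [sphereMeasure, Measure.smul_apply]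
  rw [Measure.toSphere_apply' _ hs, Measure.toSphere_apply' _ (hmeas hs),
    Ioo_smul_image_preimage_sphereHomeomorph]
  congr 2
  exact L.measurePreserving.measure_preimage_equiv (f := L.toHomeomorph.toMeasurableEquiv) _

theorem integral_sphere_comp_isometry (L : E ≃ₗᵢ[ℝ] E) (F : E → ℝ) :
    ∫ ζ, F (L ζ) ∂sphereMeasure E = ∫ ζ, F ζ ∂sphereMeasure E :=
  (measurePreserving_sphereHomeomorph L).integral_comp
    (sphereHomeomorph L).measurableEmbedding (fun ζ : sphere (0 : E) 1 => F ζ)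

theorem integral_sphere_eq_zero_of_odd {F : E → ℝ} (hF : ∀ x, F (-x) = -F x) :
    ∫ ζ, F ζ ∂sphereMeasure E = 0 := by
  have hneg := integral_sphere_comp_isometry (LinearIsometryEquiv.neg ℝ (E := E)) F
  simp only [LinearIsometryEquiv.coe_neg, hF, integral_neg] at hneg
  linarith

theorem integrable_sphere [Nontrivial E] {F : E → ℝ} (hF : ContinuousOn F (sphere 0 1)) :
    Integrable (fun ζ : sphere (0 : E) 1 => F ζ) (sphereMeasure E) :=
  integrable_of_continuous_of_compactSpace hF.domRestrict

end SphereMeasure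

section Rotation

variable {E : Type*} [NormedAddCommGroup E] [InnerProductSpace ℝ E]

theorem exp_mem_unitary_of_skewAdjoint [CompleteSpace E] {A : E →L[ℝ] E}
    (hA : A ∈ skewAdjoint (E →L[ℝ] E)) : NormedSpace.exp A ∈ unitary (E →L[ℝ] E) := by
  let : NormedAlgebra ℚ (E →L[ℝ] E) := .restrictScalars ℚ ℝ _
  exact NormedSpace.exp_mem_unitary_of_mem_skewAdjoint hA

theorem sum_rotation_mul_inner {ι : Type*} [Fintype ι] (b : OrthonormalBasis ι ℝ E)
    (L : E →L[ℝ] ℝ) (c : ℝ) (y : E) {x : E} (hx : ‖x‖ = 1) :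
    ∑ j, (⟪b j, x⟫_ℝ * (⟪b j, x⟫_ℝ * L y + c * ⟪b j, y⟫_ℝ)
        - ⟪y, x⟫_ℝ * (⟪b j, x⟫_ℝ * L (b j) + c * ⟪b j, b j⟫_ℝ)) =
      L y - ⟪y, x⟫_ℝ * L x - (Fintype.card ι - 1) * (c * ⟪y, x⟫_ℝ) := by
  have hLx : ∑ j, ⟪b j, x⟫_ℝ * L (b j) = L x := by
    simpa using congrArg L (b.sum_repr' x)
  have hyx : ∑ j, ⟪b j, x⟫_ℝ * ⟪b j, y⟫_ℝ = ⟪y, x⟫_ℝ := by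
    simpa [real_inner_comm, mul_comm] using b.sum_inner_mul_inner y x
  have hxx : ∑ j, ⟪b j, x⟫_ℝ ^ 2 = 1 := by
    simpa [hx] using b.sum_sq_inner_right x
  calc _ = (∑ j, ⟪b j, x⟫_ℝ ^ 2) * L y + c * ∑ j, ⟪b j, x⟫_ℝ * ⟪b j, y⟫_ℝ
        - ⟪y, x⟫_ℝ * ∑ j, ⟪b j, x⟫_ℝ * L (b j) - ∑ _j : ι, c * ⟪y, x⟫_ℝ := by
        simp only [Finset.sum_mul, Finset.mul_sum, ← Finset.sum_add_distrib,
          ← Finset.sum_sub_distrib]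
        refine Finset.sum_congr rfl fun j _ => ?_
        rw [real_inner_self_eq_norm_sq, b.norm_eq_one]
        ring
    _ = _ := by
        rw [hLx, hyx, hxx, Finset.sum_const, Finset.card_univ, nsmul_eq_mul]
        ring

variable [FiniteDimensional ℝ E] [MeasurableSpace E] [BorelSpace E] [Nontrivial E]
  {F : E → ℝ} {F' : E → E →L[ℝ] ℝ}

theorem integral_sphere_fderiv_skewAdjoint (hF : ∀ ζ ∈ sphere (0 : E) 1, HasFDerivAt F (F' ζ) ζ)
    (hF' : ContinuousOn F' (sphere (0 : E) 1)) {A : E →L[ℝ] E}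
    (hA : A ∈ skewAdjoint (E →L[ℝ] E)) : ∫ ζ, F' ζ (A ζ) ∂sphereMeasure E = 0 := by
  have hunitary (t : ℝ) : NormedSpace.exp (t • A) ∈ unitary (E →L[ℝ] E) :=
    exp_mem_unitary_of_skewAdjoint (skewAdjoint.smul_mem t hA)
  have hmem (t : ℝ) (ζ : sphere (0 : E) 1) : NormedSpace.exp (t • A) ζ ∈ sphere (0 : E) 1 := by
    simp [ContinuousLinearMap.norm_map_of_mem_unitary (hunitary t)]
  have hinv (t : ℝ) : ∫ ζ : sphere (0 : E) 1, F (NormedSpace.exp (t • A) ζ) ∂sphereMeasure E =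
      ∫ ζ, F ζ ∂sphereMeasure E :=
    integral_sphere_comp_isometry (Unitary.linearIsometryEquiv ⟨_, hunitary t⟩) F
  have hflow : Continuous fun p : ℝ × sphere (0 : E) 1 => NormedSpace.exp (p.1 • A) (p.2 : E) :=
    ((differentiable_exp_smul_const ℝ A).continuous.comp continuous_fst).clm_apply
      (by fun_prop)
  have hFc : ContinuousOn F (sphere 0 1) := fun ζ hζ =>
    (hF ζ hζ).continuousAt.continuousWithinAt
  have hderiv := hasDerivAt_integral_of_compactSpace (μ := sphereMeasure E) isOpen_univ
    (g := fun t ζ => F (NormedSpace.exp (t • A) ζ))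
    (g' := fun t ζ => F' (NormedSpace.exp (t • A) ζ) (A (NormedSpace.exp (t • A) ζ)))
    (fun t _ => hFc.comp_continuous (by fun_prop) (hmem t))
    (fun t _ ζ => (hF _ (hmem t ζ)).comp_hasDerivAt t
      (by simpa using (hasDerivAt_exp_smul_const' A t).clm_apply (hasDerivAt_const t (ζ : E))))
    ((hF'.comp_continuous hflow fun p => hmem p.1 p.2).clm_apply
      (A.continuous.comp hflow)).continuousOn (mem_univ 0)
  simp only [hinv] at hderiv
  simpa using hderiv.unique (hasDerivAt_const 0 _)

theorem integral_sphere_fderiv_rotation (hF : ∀ ζ ∈ sphere (0 : E) 1, HasFDerivAt F (F' ζ) ζ)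
    (hF' : ContinuousOn F' (sphere (0 : E) 1)) (u w : E) :
    ∫ ζ : sphere (0 : E) 1, (⟪u, ζ⟫_ℝ * F' ζ w - ⟪w, ζ⟫_ℝ * F' ζ u) ∂sphereMeasure E = 0 := by
  have hA : rankOne ℝ w u - rankOne ℝ u w ∈ skewAdjoint (E →L[ℝ] E) := by
    simp [skewAdjoint.mem_iff, ContinuousLinearMap.star_eq_adjoint]
  simpa using integral_sphere_fderiv_skewAdjoint hF hF' hA

theorem integral_sphere_fderiv_sub_radial
    (hF : ∀ ζ ∈ sphere (0 : E) 1, HasFDerivAt F (F' ζ) ζ)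
    (hF' : ContinuousOn F' (sphere (0 : E) 1)) (y : E) :
    ∫ ζ : sphere (0 : E) 1, (F' ζ y - ⟪y, ζ⟫_ℝ * F' ζ ζ) ∂sphereMeasure E =
      (Module.finrank ℝ E - 1) * ∫ ζ : sphere (0 : E) 1, F ζ * ⟪y, ζ⟫_ℝ ∂sphereMeasure E := by
  have hFc : ContinuousOn F (sphere 0 1) := fun ζ hζ =>
    (hF ζ hζ).continuousAt.continuousWithinAt
  have b := stdOrthonormalBasis ℝ E
  have hrot (j) : ∫ ζ : sphere (0 : E) 1,
      (⟪b j, ζ⟫_ℝ * (⟪b j, ζ⟫_ℝ * F' ζ y + F ζ * ⟪b j, y⟫_ℝ)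
        - ⟪y, ζ⟫_ℝ * (⟪b j, ζ⟫_ℝ * F' ζ (b j) + F ζ * ⟪b j, b j⟫_ℝ)) ∂sphereMeasure E = 0 := by
    have := integral_sphere_fderiv_rotation (F := fun x => F x * ⟪b j, x⟫_ℝ)
      (fun ζ hζ => (hF ζ hζ).mul (innerSL ℝ (b j)).hasFDerivAt) (by fun_prop) (b j) y
    simpa [add_comm] using this
  have hsum := Finset.sum_eq_zero fun j (_ : j ∈ Finset.univ) => hrot j
  rw [← integral_finsetSum _ fun j _ => integrable_sphere (F := fun x =>
    ⟪b j, x⟫_ℝ * (⟪b j, x⟫_ℝ * F' x y + F x * ⟪b j, y⟫_ℝ)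
      - ⟪y, x⟫_ℝ * (⟪b j, x⟫_ℝ * F' x (b j) + F x * ⟪b j, b j⟫_ℝ)) (by fun_prop)] at hsum
  simp only [sum_rotation_mul_inner b _ _ y (norm_eq_of_mem_sphere _), Fintype.card_fin] at hsum
  have hcont : ContinuousOn (fun x => F' x y - ⟪y, x⟫_ℝ * F' x x) (sphere (0 : E) 1) :=
    (by fun_prop : ContinuousOn (fun x => F' x y) _).sub
      (ContinuousOn.mul (by fun_prop) (hF'.clm_apply continuousOn_id))
  rw [integral_sub (integrable_sphere hcont)
    ((integrable_sphere (F := fun x => F x * ⟪y, x⟫_ℝ) (by fun_prop)).const_mul _),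
    integral_const_mul] at hsum
  linarith

end Rotation

section HeightDistribution

theorem hasDerivAt_ite_le {G : Type*} [NormedAddCommGroup G] [NormedSpace ℝ G] {f g : ℝ → G}
    {f' g' : G} {x t : ℝ} (hf : x ≤ t → HasDerivAt f f' x) (hg : t ≤ x → HasDerivAt g g' x)
    (hfg : f t = g t) (hfg' : x = t → f' = g') :
    HasDerivAt (fun y => if y ≤ t then f y else g y) (if x ≤ t then f' else g') x := by
  rcases lt_trichotomy x t with hxt | rfl | htx
  · rw [if_pos hxt.le]
    refine (hf hxt.le).congr_of_eventuallyEq ?_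
    filter_upwards [Iio_mem_nhds hxt] with y hy using if_pos (mem_Iio.1 hy).le
  · rw [if_pos le_rfl, ← hasDerivWithinAt_univ, ← Iic_union_Ici (a := x)]
    refine .union ((hf le_rfl).hasDerivWithinAt.congr (fun y hy => if_pos hy) (if_pos le_rfl)) ?_
    rw [hfg' rfl]
    refine (hg le_rfl).hasDerivWithinAt.congr (fun y hy => ?_) (by rw [if_pos le_rfl, hfg])
    rcases eq_or_lt_of_le (mem_Ici.1 hy) with rfl | hxy
    · rw [if_pos le_rfl, hfg]
    · exact if_neg hxy.not_ge
  · rw [if_neg htx.not_ge]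
    refine (hg htx.le).congr_of_eventuallyEq ?_
    filter_upwards [Ioi_mem_nhds htx] with y hy using if_neg (mem_Ioi.1 hy).not_ge

/-- The solution `f` of Stein's equation `(1 - x²) f' - 2 x f = |x - t| - (1 + t²) / 2` for the
uniform law on `[-1, 1]` that is bounded on this interval. -/
noncomputable def steinSolution (t x : ℝ) : ℝ :=
  if x ≤ t then 1 / 2 - (1 - t) ^ 2 / (2 * (1 - x)) else -(1 / 2) + (1 + t) ^ 2 / (2 * (1 + x))

/-- The derivative of `steinSolution t`. -/
noncomputable def steinSolutionDeriv (t x : ℝ) : ℝ :=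
  if x ≤ t then -((1 - t) ^ 2 / (2 * (1 - x) ^ 2)) else -((1 + t) ^ 2 / (2 * (1 + x) ^ 2))

variable {t x : ℝ}

theorem hasDerivAt_steinSolution (ht : t ∈ Ioo (-1) 1) (x : ℝ) :
    HasDerivAt (steinSolution t) (steinSolutionDeriv t x) x := by
  obtain ⟨ht₁, ht₂⟩ := ht
  refine hasDerivAt_ite_le (fun hxt => ?_) (fun htx => ?_) ?_ ?_
  · have hx : 1 - x ≠ 0 := by linarith
    have hden : HasDerivAt (fun y : ℝ => 2 * (1 - y)) (-2) x := by
      simpa using ((hasDerivAt_id x).const_sub 1).const_mul 2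
    refine (((hasDerivAt_const x ((1 - t) ^ 2)).fun_div hden (by positivity)).const_sub
      (1 / 2)).congr_deriv ?_
    field
  · have hx : 1 + x ≠ 0 := by linarith
    have hden : HasDerivAt (fun y : ℝ => 2 * (1 + y)) 2 x := by
      simpa using ((hasDerivAt_id x).const_add 1).const_mul 2
    refine (((hasDerivAt_const x ((1 + t) ^ 2)).fun_div hden (by positivity)).const_add
      (-(1 / 2))).congr_deriv ?_
    field
  · have : 1 - t ≠ 0 := by linarith
    have : 1 + t ≠ 0 := by linarith
    field
  · rintro rfl
    have : 1 - x ≠ 0 := by linarith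
    have : 1 + x ≠ 0 := by linarith
    field

theorem continuous_steinSolution (ht : t ∈ Ioo (-1) 1) : Continuous (steinSolution t) :=
  continuous_iff_continuousAt.2 fun x => (hasDerivAt_steinSolution ht x).continuousAt

theorem continuous_steinSolutionDeriv (ht : t ∈ Ioo (-1) 1) :
    Continuous (steinSolutionDeriv t) := by
  obtain ⟨ht₁, ht₂⟩ := ht
  refine continuous_if_le continuous_id continuous_const ?_ ?_ ?_
  · exact (ContinuousOn.div₀ (by fun_prop) (by fun_prop) fun x (hx : x ≤ t) => by
      have : 1 - x ≠ 0 := by linarith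
      positivity).neg
  · exact (ContinuousOn.div₀ (by fun_prop) (by fun_prop) fun x (hx : t ≤ x) => by
      have : 1 + x ≠ 0 := by linarith
      positivity).neg
  · rintro x rfl
    have : 1 - x ≠ 0 := by linarith
    have : 1 + x ≠ 0 := by linarith
    field

theorem steinSolution_equation (ht : t ∈ Ioo (-1) 1) (x : ℝ) :
    (1 - x ^ 2) * steinSolutionDeriv t x - 2 * x * steinSolution t x =
      |x - t| - (1 + t ^ 2) / 2 := by
  obtain ⟨ht₁, ht₂⟩ := ht
  rw [steinSolution, steinSolutionDeriv]
  split_ifs with hxt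
  · have hx : 1 - x ≠ 0 := by linarith
    rw [abs_of_nonpos (by linarith)]
    field
  · have hx : 1 + x ≠ 0 := by linarith
    rw [abs_of_nonneg (by linarith)]
    field

theorem mul_steinSolution_add_neg_of_pos (ht : t ∈ Ioo (-1) 1) (hx : 0 < x) :
    x * steinSolution t x + -x * steinSolution t (-x) < 0 := by
  obtain ⟨ht₁, ht₂⟩ := ht
  have hx₁ : 1 + x ≠ 0 := by linarith
  rcases le_or_gt x t with hxt | htx
  · have hx₂ : 0 < 1 - x := by linarith
    have : 0 < 1 - t := by linarith
    rw [steinSolution, steinSolution, if_pos hxt, if_pos (by linarith),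
      sub_neg_eq_add]
    calc _ = -((1 - t) ^ 2 * x ^ 2 / ((1 - x) * (1 + x))) := by field
      _ < 0 := neg_neg_of_pos (by positivity)
  rcases le_or_gt (-x) t with hxt | htx'
  · have hxt₂ : 0 < x - t ^ 2 := by nlinarith
    rw [steinSolution, steinSolution, if_neg htx.not_ge, if_pos hxt, sub_neg_eq_add]
    calc _ = -(x * (x - t ^ 2) / (1 + x)) := by field
      _ < 0 := neg_neg_of_pos (by positivity)
  · have hx₂ : 0 < 1 + -x := by linarith
    have : 0 < 1 + t := by linarith
    rw [steinSolution, steinSolution, if_neg htx.not_ge, if_neg htx'.not_ge]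
    calc _ = -((1 + t) ^ 2 * x ^ 2 / ((1 + -x) * (1 + x))) := by field
      _ < 0 := neg_neg_of_pos (by positivity)

theorem mul_steinSolution_add_neg (ht : t ∈ Ioo (-1) 1) (hx : x ≠ 0) :
    x * steinSolution t x + -x * steinSolution t (-x) < 0 := by
  rcases abs_choice x with habs | habs
  · exact mul_steinSolution_add_neg_of_pos ht (habs ▸ abs_pos.2 hx)
  · have := mul_steinSolution_add_neg_of_pos ht (habs ▸ abs_pos.2 hx)
    rwa [neg_neg, add_comm] at this

variable {E : Type*} [NormedAddCommGroup E] [InnerProductSpace ℝ E] [FiniteDimensional ℝ E]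
  [MeasurableSpace E] [BorelSpace E] [Nontrivial E] {e : E}

theorem integral_inner_mul_steinSolution_neg (he : ‖e‖ = 1) (ht : t ∈ Ioo (-1) 1) :
    ∫ ζ : sphere (0 : E) 1, ⟪e, ζ⟫_ℝ * steinSolution t ⟪e, ζ⟫_ℝ ∂sphereMeasure E < 0 := by
  have hcont := continuous_steinSolution ht
  have hsymm : ∫ ζ : sphere (0 : E) 1, (⟪e, ζ⟫_ℝ * steinSolution t ⟪e, ζ⟫_ℝ
      + -⟪e, ζ⟫_ℝ * steinSolution t (-⟪e, ζ⟫_ℝ)) ∂sphereMeasure E =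
      2 * ∫ ζ : sphere (0 : E) 1, ⟪e, ζ⟫_ℝ * steinSolution t ⟪e, ζ⟫_ℝ ∂sphereMeasure E := by
    have hneg := integral_sphere_comp_isometry (LinearIsometryEquiv.neg ℝ)
      fun x : E => ⟪e, x⟫_ℝ * steinSolution t ⟪e, x⟫_ℝ
    simp only [LinearIsometryEquiv.coe_neg, inner_neg_right] at hneg
    rw [integral_add (integrable_of_continuous_of_compactSpace (by fun_prop))
      (integrable_of_continuous_of_compactSpace (by fun_prop)), hneg, two_mul]
  have hpos : 0 < ∫ ζ : sphere (0 : E) 1, -(⟪e, ζ⟫_ℝ * steinSolution t ⟪e, ζ⟫_ℝ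
      + -⟪e, ζ⟫_ℝ * steinSolution t (-⟪e, ζ⟫_ℝ)) ∂sphereMeasure E := by
    refine Continuous.integral_pos_of_hasCompactSupport_nonneg_nonzero (by fun_prop)
      (.of_compactSpace _) (fun ζ => ?_) (x := ⟨e, by simpa using he⟩) ?_
    · rcases eq_or_ne ⟪e, (ζ : E)⟫_ℝ 0 with hζ | hζ
      · simp [hζ]
      · exact (neg_pos.2 (mul_steinSolution_add_neg ht hζ)).le
    · have heval := mul_steinSolution_add_neg ht one_ne_zero
      simpa [he] using (neg_pos.2 heval).ne'
  rw [integral_neg, hsymm] at hpos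
  linarith

theorem integral_one_sub_inner_sq_mul_deriv {f f' : ℝ → ℝ} (hf : ∀ x, HasDerivAt f (f' x) x)
    (hf' : Continuous f') (he : ‖e‖ = 1) :
    ∫ ζ : sphere (0 : E) 1, (1 - ⟪e, ζ⟫_ℝ ^ 2) * f' ⟪e, ζ⟫_ℝ ∂sphereMeasure E =
      (Module.finrank ℝ E - 1) *
        ∫ ζ : sphere (0 : E) 1, ⟪e, ζ⟫_ℝ * f ⟪e, ζ⟫_ℝ ∂sphereMeasure E := by
  have hibp := integral_sphere_fderiv_sub_radial
    (fun ζ _ => (hf ⟪e, ζ⟫_ℝ).comp_hasFDerivAt ζ (innerSL ℝ e).hasFDerivAt) (by fun_prop) e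
  simp only [smul_apply, innerSL_apply_apply, real_inner_self_eq_norm_sq, he, smul_eq_mul,
    Function.comp_apply, mul_comm _ ⟪e, _⟫_ℝ] at hibp
  rw [← hibp]
  congr with ζ
  ring

theorem integral_abs_inner_sub (he : ‖e‖ = 1) (ht : t ∈ Ioo (-1) 1) :
    ∫ ζ : sphere (0 : E) 1, |⟪e, ζ⟫_ℝ - t| ∂sphereMeasure E =
      (1 + t ^ 2) / 2 + (Module.finrank ℝ E - 3) *
        ∫ ζ : sphere (0 : E) 1, ⟪e, ζ⟫_ℝ * steinSolution t ⟪e, ζ⟫_ℝ ∂sphereMeasure E := by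
  have hcont := continuous_steinSolution ht
  have hcont' := continuous_steinSolutionDeriv ht
  have hpoint (ζ : sphere (0 : E) 1) : |⟪e, ζ⟫_ℝ - t| =
      (1 + t ^ 2) / 2 + (1 - ⟪e, ζ⟫_ℝ ^ 2) * steinSolutionDeriv t ⟪e, ζ⟫_ℝ
        - 2 * (⟪e, ζ⟫_ℝ * steinSolution t ⟪e, ζ⟫_ℝ) := by
    linarith [steinSolution_equation ht ⟪e, (ζ : E)⟫_ℝ]
  simp only [hpoint]
  rw [integral_sub (integrable_of_continuous_of_compactSpace (by fun_prop))
      (integrable_of_continuous_of_compactSpace (by fun_prop)),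
    integral_add (integrable_const _) (integrable_of_continuous_of_compactSpace (by fun_prop)),
    integral_one_sub_inner_sq_mul_deriv (hasDerivAt_steinSolution ht) hcont' he,
    integral_const_mul, integral_const, probReal_univ, one_smul]
  ring

theorem integral_abs_inner_sub_le (hE : 3 ≤ Module.finrank ℝ E) (he : ‖e‖ = 1)
    (ht : t ∈ Ioo (-1) 1) :
    ∫ ζ : sphere (0 : E) 1, |⟪e, ζ⟫_ℝ - t| ∂sphereMeasure E ≤ (1 + t ^ 2) / 2 := by
  have hE' : (3 : ℝ) ≤ Module.finrank ℝ E := by exact_mod_cast hE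
  rw [integral_abs_inner_sub he ht]
  nlinarith [integral_inner_mul_steinSolution_neg he ht]

theorem integral_abs_inner_sub_lt (hE : 4 ≤ Module.finrank ℝ E) (he : ‖e‖ = 1)
    (ht : t ∈ Ioo (-1) 1) :
    ∫ ζ : sphere (0 : E) 1, |⟪e, ζ⟫_ℝ - t| ∂sphereMeasure E < (1 + t ^ 2) / 2 := by
  have hE' : (4 : ℝ) ≤ Module.finrank ℝ E := by exact_mod_cast hE
  rw [integral_abs_inner_sub he ht]
  nlinarith [integral_inner_mul_steinSolution_neg he ht]

/-- The bathtub principle in its dual form: `t` is the Lagrange multiplier of the mean. -/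
theorem integral_inner_mul_le {φ : sphere (0 : E) 1 → ℝ} (hφ : Continuous φ)
    (hφ₁ : ∀ ζ, |φ ζ| ≤ 1) (e : E) (t : ℝ) :
    ∫ ζ, ⟪e, ζ⟫_ℝ * φ ζ ∂sphereMeasure E ≤
      ∫ ζ : sphere (0 : E) 1, |⟪e, ζ⟫_ℝ - t| ∂sphereMeasure E
        + t * ∫ ζ, φ ζ ∂sphereMeasure E := by
  rw [← integral_const_mul, ← integral_add
    (integrable_of_continuous_of_compactSpace (by fun_prop))
    (integrable_of_continuous_of_compactSpace (by fun_prop))]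
  refine integral_mono (integrable_of_continuous_of_compactSpace (by fun_prop))
    (integrable_of_continuous_of_compactSpace (by fun_prop)) fun ζ => ?_
  have hle : (⟪e, ζ⟫_ℝ - t) * φ ζ ≤ |⟪e, ζ⟫_ℝ - t| :=
    (le_abs_self _).trans (by
      rw [abs_mul]; exact mul_le_of_le_one_right (abs_nonneg _) (hφ₁ ζ))
  linarith

end HeightDistribution

section SphericalMean

variable {E : Type*} [NormedAddCommGroup E] [InnerProductSpace ℝ E]

theorem smul_mem_ball_of_mem_sphere {r : ℝ} (hr : r ∈ Ioo (-1) 1) {x : E}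
    (hx : x ∈ sphere (0 : E) 1) : r • x ∈ ball (0 : E) 1 := by
  rw [mem_ball_zero_iff, norm_smul, mem_sphere_zero_iff_norm.1 hx, mul_one, Real.norm_eq_abs]
  exact abs_lt.2 hr

theorem hasFDerivAt_comp_const_smul {F : E → ℝ} {F' : E →L[ℝ] ℝ} {r : ℝ} {x : E}
    (hF : HasFDerivAt F F' (r • x)) : HasFDerivAt (fun y => F (r • y)) (r • F') x := by
  refine (hF.comp x ((hasFDerivAt_id (𝕜 := ℝ) x).const_smul r)).congr_fderiv ?_
  ext v
  simp

theorem hasFDerivAt_fderiv_apply_of_contDiffOn {h : E → ℝ} (hh : ContDiffOn ℝ 2 h (ball 0 1))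
    {x : E} (hx : x ∈ ball (0 : E) 1) (v : E) :
    HasFDerivAt (fun y => fderiv ℝ h y v) ((fderiv ℝ (fderiv ℝ h) x).flip v) x := by
  have hdiff : DifferentiableAt ℝ (fderiv ℝ h) x :=
    ((hh.contDiffAt (isOpen_ball.mem_nhds hx)).fderiv_right (m := 1) le_rfl).differentiableAt
      one_ne_zero
  simpa using hdiff.hasFDerivAt.clm_apply (hasFDerivAt_const v x)

theorem fderiv_fderiv_apply_comm_of_contDiffOn {h : E → ℝ} (hh : ContDiffOn ℝ 2 h (ball 0 1))
    {x : E} (hx : x ∈ ball (0 : E) 1) (v w : E) :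
    fderiv ℝ (fderiv ℝ h) x v w = fderiv ℝ (fderiv ℝ h) x w v :=
  (hh.contDiffAt (isOpen_ball.mem_nhds hx)).isSymmSndFDerivAt (by simp) v w

variable [FiniteDimensional ℝ E]

theorem laplacian_eq_sum_fderiv_fderiv {ι : Type*} [Fintype ι] (b : OrthonormalBasis ι ℝ E)
    (f : E → ℝ) (x : E) :
    Laplacian.laplacian f x = ∑ i, fderiv ℝ (fderiv ℝ f) x (b i) (b i) := by
  rw [laplacian_eq_iteratedFDeriv_orthonormalBasis f b]
  simp [iteratedFDeriv_two_apply]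

variable [MeasurableSpace E] [BorelSpace E]

/-- The mean of `h` over the sphere of radius `r` centred at the origin. -/
noncomputable def sphereMean (h : E → ℝ) (r : ℝ) : ℝ :=
  ∫ ζ : sphere (0 : E) 1, h (r • ζ) ∂sphereMeasure E

/-- The first moment of `h` over the sphere of radius `r`, in the direction `e`. The weight is the
linear function of the unit vector `ζ`, not of the point `r • ζ`. -/
noncomputable def sphereMoment (h : E → ℝ) (e : E) (r : ℝ) : ℝ :=
  ∫ ζ : sphere (0 : E) 1, ⟪e, ζ⟫_ℝ * h (r • ζ) ∂sphereMeasure E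

theorem sphereMoment_zero (h : E → ℝ) (e : E) : sphereMoment h e 0 = 0 := by
  simpa [sphereMoment] using integral_sphere_eq_zero_of_odd (F := fun x : E => ⟪e, x⟫_ℝ * h 0)
    (by simp)

variable [Nontrivial E] {h : E → ℝ} {e : E} {r : ℝ}

theorem sphereMean_zero (h : E → ℝ) : sphereMean h 0 = h 0 := by
  simp [sphereMean]

theorem hasDerivAt_integral_sphere_clm_apply {G : Type*} [NormedAddCommGroup G] [NormedSpace ℝ G]
    {F : E → G} (hF : ContDiffOn ℝ 1 F (ball 0 1)) {ω : sphere (0 : E) 1 → G →L[ℝ] ℝ}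
    (hω : Continuous ω) (hr : r ∈ Ioo (-1) 1) :
    HasDerivAt (fun s => ∫ ζ, ω ζ (F (s • ζ)) ∂sphereMeasure E)
      (∫ ζ, ω ζ (fderiv ℝ F (r • ζ) ζ) ∂sphereMeasure E) r := by
  have hmem (s : ℝ) (hs : s ∈ Ioo (-1) 1) (ζ : sphere (0 : E) 1) : s • (ζ : E) ∈ ball 0 1 :=
    smul_mem_ball_of_mem_sphere hs ζ.2
  have hF' : ContinuousOn (fun p : ℝ × sphere (0 : E) 1 => fderiv ℝ F (p.1 • (p.2 : E)) p.2)
      (Ioo (-1) 1 ×ˢ univ) :=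
    ((hF.continuousOn_fderiv_of_isOpen isOpen_ball le_rfl).comp (by fun_prop)
      fun p hp => hmem p.1 hp.1 p.2).clm_apply (by fun_prop)
  refine hasDerivAt_integral_of_compactSpace isOpen_Ioo (g := fun s ζ => ω ζ (F (s • (ζ : E))))
    (g' := fun s ζ => ω ζ (fderiv ℝ F (s • (ζ : E)) ζ)) (fun s hs => ?_) (fun s hs ζ => ?_)
    ((hω.comp continuous_snd).continuousOn.clm_apply hF') hr
  · exact hω.clm_apply (hF.continuousOn.comp_continuous (by fun_prop) (hmem s hs))
  · have hdiff : DifferentiableAt ℝ F (s • (ζ : E)) :=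
      (hF.contDiffAt (isOpen_ball.mem_nhds (hmem s hs ζ))).differentiableAt one_ne_zero
    have hray : HasDerivAt (fun t : ℝ => t • (ζ : E)) ζ s := by
      simpa using (hasDerivAt_id s).smul_const (ζ : E)
    exact (ω ζ).hasFDerivAt.comp_hasDerivAt s (hdiff.hasFDerivAt.comp_hasDerivAt s hray)

theorem hasDerivAt_sphereMean (hh : ContDiffOn ℝ 1 h (ball 0 1)) (hr : r ∈ Ioo (-1) 1) :
    HasDerivAt (sphereMean h) (∫ ζ : sphere (0 : E) 1, fderiv ℝ h (r • ζ) ζ ∂sphereMeasure E) r :=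
  hasDerivAt_integral_sphere_clm_apply hh (ω := fun _ => .id ℝ ℝ) continuous_const hr

theorem hasDerivAt_sphereMoment (hh : ContDiffOn ℝ 1 h (ball 0 1)) (e : E)
    (hr : r ∈ Ioo (-1) 1) :
    HasDerivAt (sphereMoment h e)
      (∫ ζ : sphere (0 : E) 1, ⟪e, ζ⟫_ℝ * fderiv ℝ h (r • ζ) ζ ∂sphereMeasure E) r :=
  hasDerivAt_integral_sphere_clm_apply hh
    (ω := fun ζ => ⟪e, (ζ : E)⟫_ℝ • ContinuousLinearMap.id ℝ ℝ) (by fun_prop) hr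

theorem hasDerivAt_deriv_sphereMean (hh : ContDiffOn ℝ 2 h (ball 0 1)) (hr : r ∈ Ioo (-1) 1) :
    HasDerivAt (deriv (sphereMean h))
      (∫ ζ : sphere (0 : E) 1, fderiv ℝ (fderiv ℝ h) (r • ζ) ζ ζ ∂sphereMeasure E) r := by
  refine (hasDerivAt_integral_sphere_clm_apply (hh.fderiv_of_isOpen isOpen_ball (m := 1) le_rfl)
    (ω := fun ζ => .apply ℝ ℝ (ζ : E)) (by fun_prop) hr).congr_of_eventuallyEq ?_
  filter_upwards [isOpen_Ioo.mem_nhds hr] with s hs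
  exact (hasDerivAt_sphereMean (hh.of_le one_le_two) hs).deriv

theorem hasDerivAt_sphereMean_fderiv (hh : ContDiffOn ℝ 2 h (ball 0 1)) (e : E)
    (hr : r ∈ Ioo (-1) 1) :
    HasDerivAt (sphereMean fun x => fderiv ℝ h x e)
      (∫ ζ : sphere (0 : E) 1, fderiv ℝ (fderiv ℝ h) (r • ζ) ζ e ∂sphereMeasure E) r :=
  hasDerivAt_integral_sphere_clm_apply (hh.fderiv_of_isOpen isOpen_ball (m := 1) le_rfl)
    (ω := fun _ => .apply ℝ ℝ e) continuous_const hr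

theorem mul_deriv_sphereMoment (hh : ContDiffOn ℝ 1 h (ball 0 1)) (e : E) (hr : r ∈ Ioo (-1) 1) :
    r * deriv (sphereMoment h e) r + (Module.finrank ℝ E - 1) * sphereMoment h e r =
      r * sphereMean (fun x => fderiv ℝ h x e) r := by
  have hmem (ζ) (hζ : ζ ∈ sphere (0 : E) 1) : r • ζ ∈ ball (0 : E) 1 :=
    smul_mem_ball_of_mem_sphere hr hζ
  have hh' : ContinuousOn (fun x : E => fderiv ℝ h (r • x)) (sphere 0 1) :=
    (hh.continuousOn_fderiv_of_isOpen isOpen_ball le_rfl).comp (by fun_prop) hmem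
  have hibp := integral_sphere_fderiv_sub_radial (F := fun x => h (r • x))
    (fun ζ hζ => hasFDerivAt_comp_const_smul ((hh.contDiffAt
      (isOpen_ball.mem_nhds (hmem ζ hζ))).differentiableAt one_ne_zero).hasFDerivAt)
    (hh'.const_smul r) e
  have hmoment : ∫ ζ : sphere (0 : E) 1, h (r • ζ) * ⟪e, ζ⟫_ℝ ∂sphereMeasure E =
      sphereMoment h e r := by
    simp only [sphereMoment, mul_comm]
  have hsplit (ζ : sphere (0 : E) 1) : (r • fderiv ℝ h (r • (ζ : E))) e
      - ⟪e, ζ⟫_ℝ * (r • fderiv ℝ h (r • (ζ : E))) ζ =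
      r * (fderiv ℝ h (r • (ζ : E)) e - ⟪e, ζ⟫_ℝ * fderiv ℝ h (r • (ζ : E)) ζ) := by
    simp only [smul_apply, smul_eq_mul]
    ring
  simp only [hsplit, hmoment] at hibp
  rw [integral_const_mul, integral_sub (integrable_sphere (F := fun x => fderiv ℝ h (r • x) e)
      (by fun_prop)) (integrable_sphere (F := fun x => ⟪e, x⟫_ℝ * fderiv ℝ h (r • x) x)
      (ContinuousOn.mul (by fun_prop) (hh'.clm_apply continuousOn_id)))] at hibp
  rw [(hasDerivAt_sphereMoment hh e hr).deriv, ← hibp, sphereMean]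
  ring

theorem deriv_sphereMean_eq_sum_sphereMoment {ι : Type*} [Fintype ι] (b : OrthonormalBasis ι ℝ E)
    (hh : ContDiffOn ℝ 1 h (ball 0 1)) (hr : r ∈ Ioo (-1) 1) :
    deriv (sphereMean h) r = ∑ i, sphereMoment (fun x => fderiv ℝ h x (b i)) (b i) r := by
  have hh' : ContinuousOn (fun x : E => fderiv ℝ h (r • x)) (sphere 0 1) :=
    (hh.continuousOn_fderiv_of_isOpen isOpen_ball le_rfl).comp (by fun_prop)
      fun ζ hζ => smul_mem_ball_of_mem_sphere hr hζ
  simp only [sphereMoment]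
  rw [(hasDerivAt_sphereMean hh hr).deriv, ← integral_finsetSum _ fun i _ => integrable_sphere
    (F := fun x => ⟪b i, x⟫_ℝ * fderiv ℝ h (r • x) (b i)) (by fun_prop)]
  congr with ζ
  simpa using (congrArg (fderiv ℝ h (r • (ζ : E))) (b.sum_repr' ζ)).symm

/-- The Euler–Poisson–Darboux equation for spherical means. -/
theorem mul_deriv_deriv_sphereMean (hh : ContDiffOn ℝ 2 h (ball 0 1)) (hr : r ∈ Ioo (-1) 1) :
    r * deriv (deriv (sphereMean h)) r + (Module.finrank ℝ E - 1) * deriv (sphereMean h) r =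
      r * sphereMean (Laplacian.laplacian h) r := by
  have b := stdOrthonormalBasis ℝ E
  have hh₁ : ContDiffOn ℝ 1 h (ball 0 1) := hh.of_le one_le_two
  have hpartial (i) : ContDiffOn ℝ 1 (fun x => fderiv ℝ h x (b i)) (ball 0 1) :=
    (hh.fderiv_of_isOpen isOpen_ball le_rfl).clm_apply contDiffOn_const
  have hmean' : deriv (sphereMean h) =ᶠ[𝓝 r]
      fun s => ∑ i, sphereMoment (fun x => fderiv ℝ h x (b i)) (b i) s := by
    filter_upwards [isOpen_Ioo.mem_nhds hr] with s hs
    exact deriv_sphereMean_eq_sum_sphereMoment b hh₁ hs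
  have hlaplacian : sphereMean (Laplacian.laplacian h) r =
      ∑ i, sphereMean (fun x => fderiv ℝ (fun y => fderiv ℝ h y (b i)) x (b i)) r := by
    simp only [sphereMean]
    rw [← integral_finsetSum _ fun i _ => integrable_sphere
      (F := fun x => fderiv ℝ (fun y => fderiv ℝ h y (b i)) (r • x) (b i))
      ((((hpartial i).continuousOn_fderiv_of_isOpen isOpen_ball le_rfl).comp (by fun_prop)
        fun ζ hζ => smul_mem_ball_of_mem_sphere hr hζ).clm_apply continuousOn_const)]
    congr with ζ
    rw [laplacian_eq_sum_fderiv_fderiv b]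
    refine Finset.sum_congr rfl fun i _ => ?_
    rw [(hasFDerivAt_fderiv_apply_of_contDiffOn hh (smul_mem_ball_of_mem_sphere hr ζ.2) _).fderiv,
      ContinuousLinearMap.flip_apply]
  rw [hmean'.deriv_eq, hmean'.eq_of_nhds, deriv_fun_sum fun i _ =>
    (hasDerivAt_sphereMoment (hpartial i) (b i) hr).differentiableAt, hlaplacian, Finset.mul_sum,
    Finset.mul_sum, Finset.mul_sum, ← Finset.sum_add_distrib]
  exact Finset.sum_congr rfl fun i _ => mul_deriv_sphereMoment (hpartial i) (b i) hr

theorem deriv_sphereMean_fderiv (hh : ContDiffOn ℝ 2 h (ball 0 1)) (e : E)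
    (hr : r ∈ Ioo (-1) 1) (hr₀ : r ≠ 0) :
    deriv (sphereMean fun x => fderiv ℝ h x e) r = sphereMoment (Laplacian.laplacian h) e r := by
  have b := stdOrthonormalBasis ℝ E
  have hmem (ζ) (hζ : ζ ∈ sphere (0 : E) 1) : r • ζ ∈ ball (0 : E) 1 :=
    smul_mem_ball_of_mem_sphere hr hζ
  have hh'' : ContinuousOn (fun x : E => fderiv ℝ (fderiv ℝ h) (r • x)) (sphere 0 1) :=
    ((hh.fderiv_of_isOpen isOpen_ball (m := 1) le_rfl).continuousOn_fderiv_of_isOpen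
      isOpen_ball le_rfl).comp (by fun_prop) hmem
  have hflip : ContinuousOn (fun x : E => (fderiv ℝ (fderiv ℝ h) (r • x)).flip) (sphere 0 1) :=
    (ContinuousLinearMap.flipₗᵢ ℝ E E ℝ).continuous.comp_continuousOn hh''
  have hrot (j) : ∫ ζ : sphere (0 : E) 1,
      (⟪e, ζ⟫_ℝ * fderiv ℝ (fderiv ℝ h) (r • (ζ : E)) (b j) (b j)
        - ⟪b j, ζ⟫_ℝ * fderiv ℝ (fderiv ℝ h) (r • (ζ : E)) e (b j)) ∂sphereMeasure E = 0 := by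
    have hzero := integral_sphere_fderiv_rotation (F := fun x => fderiv ℝ h (r • x) (b j))
      (fun ζ hζ => hasFDerivAt_comp_const_smul
        (hasFDerivAt_fderiv_apply_of_contDiffOn hh (hmem ζ hζ) (b j))) (by fun_prop) e (b j)
    simp only [smul_apply, ContinuousLinearMap.flip_apply, smul_eq_mul, mul_left_comm _ r,
      ← mul_sub, integral_const_mul] at hzero
    exact (mul_eq_zero.1 hzero).resolve_left hr₀
  have hsum := Finset.sum_eq_zero fun j (_ : j ∈ Finset.univ) => hrot j
  rw [← integral_finsetSum _ fun j _ => integrable_sphere (F := fun x =>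
    ⟪e, x⟫_ℝ * fderiv ℝ (fderiv ℝ h) (r • x) (b j) (b j)
      - ⟪b j, x⟫_ℝ * fderiv ℝ (fderiv ℝ h) (r • x) e (b j)) (by fun_prop)] at hsum
  have hradial (ζ : sphere (0 : E) 1) : ∑ j, ⟪b j, ζ⟫_ℝ *
      fderiv ℝ (fderiv ℝ h) (r • (ζ : E)) e (b j) = fderiv ℝ (fderiv ℝ h) (r • (ζ : E)) ζ e := by
    rw [fderiv_fderiv_apply_comm_of_contDiffOn hh (hmem ζ ζ.2)]
    simpa using congrArg (fderiv ℝ (fderiv ℝ h) (r • (ζ : E)) e) (b.sum_repr' ζ)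
  simp only [Finset.sum_sub_distrib, hradial, ← Finset.mul_sum] at hsum
  rw [integral_sub (integrable_sphere (F := fun x =>
      ⟪e, x⟫_ℝ * ∑ j, fderiv ℝ (fderiv ℝ h) (r • x) (b j) (b j)) (by fun_prop))
    (integrable_sphere (F := fun x => fderiv ℝ (fderiv ℝ h) (r • x) x e)
      ((hh''.clm_apply continuousOn_id).clm_apply continuousOn_const)), sub_eq_zero] at hsum
  rw [(hasDerivAt_sphereMean_fderiv hh e hr).deriv, ← hsum]
  simp only [sphereMoment, laplacian_eq_sum_fderiv_fderiv b]

end SphericalMean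

section GradientBound

theorem nonneg_of_deriv_nonneg_of_neg {f f' : ℝ → ℝ} {a b : ℝ} (hab : a ≤ b)
    (hf : ∀ x ∈ Icc a b, HasDerivAt f (f' x) x) (hfa : 0 ≤ f a)
    (hf' : ∀ x ∈ Ioo a b, f x < 0 → 0 ≤ f' x) : 0 ≤ f b := by
  have hbarrier (ε : ℝ) (hε : 0 < ε) : -f b ≤ ε * (1 + (b - a)) := by
    refine image_le_of_deriv_right_lt_deriv_boundary (f := fun x => -f x) (f' := fun x => -f' x)
      (B := fun x => ε * (1 + (x - a))) (B' := fun _ => ε)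
      (fun x hx => (hf x hx).neg.continuousAt.continuousWithinAt)
      (fun x hx => (hf x (Ico_subset_Icc_self hx)).neg.hasDerivWithinAt) ?_
      (fun x => by simpa using (((hasDerivAt_id x).sub_const a).const_add 1).const_mul ε)
      (fun x hx hxB => ?_) (right_mem_Icc.2 hab)
    · rw [sub_self]
      linarith
    · have hfx : f x < 0 := by
        have : 0 < ε * (1 + (x - a)) := mul_pos hε (by linarith [hx.1])
        linarith
      have hax : a < x := hx.1.lt_of_ne (by rintro rfl; linarith)
      linarith [hf' x ⟨hax, hx.2⟩ hfx]
  have hlim : Tendsto (fun ε : ℝ => ε * (1 + (b - a))) (𝓝[>] 0) (𝓝 0) := by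
    have : ContinuousAt (fun ε : ℝ => ε * (1 + (b - a))) 0 := by fun_prop
    simpa using this.tendsto.mono_left nhdsWithin_le_nhds
  exact neg_nonpos.1 (ge_of_tendsto hlim (eventually_mem_nhdsWithin.mono hbarrier))

theorem eq_zero_of_mul_deriv_nonpos {f f' : ℝ → ℝ} {a b : ℝ} (hab : a ≤ b)
    (hf : ∀ x ∈ Icc a b, HasDerivAt f (f' x) x) (hfa : f a = 0)
    (hf' : ∀ x ∈ Ioo a b, f x * f' x ≤ 0) : f b = 0 := by
  refine le_antisymm (neg_nonneg.1 ?_) ?_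
  · exact nonneg_of_deriv_nonneg_of_neg hab (f := -f) (fun x hx => (hf x hx).neg) (by simp [hfa])
      fun x hx hfx => neg_nonneg.2 (nonpos_of_mul_nonpos_right (hf' x hx) (neg_neg_iff_pos.1 hfx))
  · exact nonneg_of_deriv_nonneg_of_neg hab hf hfa.ge
      fun x hx hfx => nonneg_of_mul_nonpos_right (hf' x hx) hfx

variable {E : Type*} [NormedAddCommGroup E]

theorem one_sub_norm_sq_pos {x : E} (hx : x ∈ ball (0 : E) 1) : 0 < 1 - ‖x‖ ^ 2 := by
  rw [mem_ball_zero_iff] at hx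
  nlinarith [norm_nonneg x]

variable [InnerProductSpace ℝ E]

theorem exists_norm_gradient_eq [CompleteSpace E] [Nontrivial E] (h : E → ℝ) (x : E) :
    ∃ e : E, ‖e‖ = 1 ∧ ‖gradient h x‖ = fderiv ℝ h x e := by
  rcases eq_or_ne (gradient h x) 0 with hzero | hne
  · obtain ⟨e, he⟩ := exists_norm_eq E (zero_le_one' ℝ)
    exact ⟨e, he, by rw [← inner_gradient_left, hzero]; simp⟩
  · have hnorm : ‖gradient h x‖ ≠ 0 := norm_ne_zero_iff.2 hne
    refine ⟨‖gradient h x‖⁻¹ • gradient h x, ?_, ?_⟩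
    · rw [norm_smul, norm_inv, norm_norm, inv_mul_cancel₀ hnorm]
    · rw [← inner_gradient_left, inner_smul_right, real_inner_self_eq_norm_sq]
      field

variable [FiniteDimensional ℝ E]

/-- `C²` solutions on the unit ball of the equation `(1 - |x|²) Δh + 2 β x · ∇h = 0`. The case
`β = 0` is harmonicity; for `β = n - 2` this is hyperbolic harmonicity, the factor `1 - |x|²`
being divided out. -/
def IsWeightedHarmonic (β : ℝ) (h : E → ℝ) : Prop :=
  ContDiffOn ℝ 2 h (ball 0 1) ∧ ∀ x ∈ ball (0 : E) 1,
    (1 - ‖x‖ ^ 2) * Laplacian.laplacian h x + 2 * β * fderiv ℝ h x x = 0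

namespace IsWeightedHarmonic

variable {β r : ℝ} {h : E → ℝ}

theorem laplacian_smul_sphere (hh : IsWeightedHarmonic β h) (hr : r ∈ Ioo (-1) 1) {ζ : E}
    (hζ : ζ ∈ sphere (0 : E) 1) :
    Laplacian.laplacian h (r • ζ) = -(2 * β * r / (1 - r ^ 2)) * fderiv ℝ h (r • ζ) ζ := by
  have heq := hh.2 _ (smul_mem_ball_of_mem_sphere hr hζ)
  have hpos := one_sub_norm_sq_pos (smul_mem_ball_of_mem_sphere hr hζ)
  rw [norm_smul, mem_sphere_zero_iff_norm.1 hζ, mul_one, Real.norm_eq_abs, sq_abs] at heq hpos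
  rw [map_smul, smul_eq_mul] at heq
  field_simp
  linarith

variable [MeasurableSpace E] [BorelSpace E] [Nontrivial E]

theorem sphereMean_laplacian (hh : IsWeightedHarmonic β h) (hr : r ∈ Ioo (-1) 1) :
    sphereMean (Laplacian.laplacian h) r = -(2 * β * r / (1 - r ^ 2)) * deriv (sphereMean h) r := by
  rw [(hasDerivAt_sphereMean (hh.1.of_le one_le_two) hr).deriv, ← integral_const_mul]
  exact integral_congr_ae (.of_forall fun ζ => hh.laplacian_smul_sphere hr ζ.2)

theorem sphereMoment_laplacian (hh : IsWeightedHarmonic β h) (e : E) (hr : r ∈ Ioo (-1) 1) :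
    sphereMoment (Laplacian.laplacian h) e r =
      -(2 * β * r / (1 - r ^ 2)) * deriv (sphereMoment h e) r := by
  rw [(hasDerivAt_sphereMoment (hh.1.of_le one_le_two) e hr).deriv, ← integral_const_mul]
  refine integral_congr_ae (.of_forall fun ζ => ?_)
  simp only [hh.laplacian_smul_sphere hr ζ.2]
  ring

theorem deriv_sphereMean_eq_zero (hh : IsWeightedHarmonic β h) (hβ : 0 ≤ β) (hr : r ∈ Ico 0 1) :
    deriv (sphereMean h) r = 0 := by
  have hsub {x : ℝ} (hx : x ∈ Icc 0 r) : x ∈ Ioo (-1) 1 :=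
    ⟨by linarith [hx.1], hx.2.trans_lt hr.2⟩
  have hcard : (1 : ℝ) ≤ Module.finrank ℝ E := by exact_mod_cast Module.finrank_pos
  have hzero : deriv (sphereMean h) 0 = 0 := by
    rw [(hasDerivAt_sphereMean (hh.1.of_le one_le_two) (by norm_num)).deriv]
    simpa using integral_sphere_eq_zero_of_odd (F := fderiv ℝ h 0) (map_neg _)
  refine eq_zero_of_mul_deriv_nonpos hr.1 (fun x hx =>
    (hasDerivAt_deriv_sphereMean hh.1 (hsub hx)).differentiableAt.hasDerivAt) hzero fun x hx => ?_
  have hx₁ : 0 < 1 - x ^ 2 := by nlinarith [hx.1, hx.2, hr.2]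
  have hepd := mul_deriv_deriv_sphereMean hh.1 (hsub (Ioo_subset_Icc_self hx))
  rw [hh.sphereMean_laplacian (hsub (Ioo_subset_Icc_self hx))] at hepd
  have hcoeff : 0 ≤ (Module.finrank ℝ E - 1) + x * (2 * β * x / (1 - x ^ 2)) :=
    add_nonneg (by linarith) (by have := hx.1; positivity)
  set p := deriv (sphereMean h)
  refine nonpos_of_mul_nonpos_right (a := x) ?_ hx.1
  calc x * (p x * deriv p x)
      = -(((Module.finrank ℝ E - 1) + x * (2 * β * x / (1 - x ^ 2))) * p x ^ 2) := by
        linear_combination p x * hepd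
    _ ≤ 0 := neg_nonpos.2 (mul_nonneg hcoeff (sq_nonneg _))

theorem sphereMean_eq (hh : IsWeightedHarmonic β h) (hβ : 0 ≤ β) (hr : r ∈ Ico 0 1) :
    sphereMean h r = h 0 := by
  rw [← sphereMean_zero h, ← sub_eq_zero]
  refine eq_zero_of_mul_deriv_nonpos hr.1 (f := fun x => sphereMean h x - sphereMean h 0)
    (fun x hx => (hasDerivAt_sphereMean (hh.1.of_le one_le_two)
      ⟨by linarith [hx.1], hx.2.trans_lt hr.2⟩).differentiableAt.hasDerivAt.sub_const _)
    (sub_self _) fun x hx => ?_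
  rw [hh.deriv_sphereMean_eq_zero hβ ⟨hx.1.le, hx.2.trans hr.2⟩, mul_zero]

theorem deriv_sphereMean_fderiv_eq (hh : IsWeightedHarmonic β h) (e : E) (hr : r ∈ Ioo 0 1) :
    deriv (sphereMean fun x => fderiv ℝ h x e) r =
      -(2 * β * r / (1 - r ^ 2)) * deriv (sphereMoment h e) r := by
  have hr₁ : r ∈ Ioo (-1) 1 := ⟨by linarith [hr.1], hr.2⟩
  rw [deriv_sphereMean_fderiv hh.1 e hr₁ hr.1.ne', hh.sphereMoment_laplacian e hr₁]

theorem mul_fderiv_eq_sphereMoment (hh : IsWeightedHarmonic 0 h) (e : E) (hr : r ∈ Ico 0 1) :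
    r * fderiv ℝ h 0 e = Module.finrank ℝ E * sphereMoment h e r := by
  have hh₁ : ContDiffOn ℝ 1 h (ball 0 1) := hh.1.of_le one_le_two
  have hsub {x : ℝ} (hx : x ∈ Icc 0 r) : x ∈ Ioo (-1) 1 :=
    ⟨by linarith [hx.1], hx.2.trans_lt hr.2⟩
  have hmean {s : ℝ} (hs : s ∈ Ico 0 1) :
      sphereMean (fun x => fderiv ℝ h x e) s = fderiv ℝ h 0 e := by
    rw [← sphereMean_zero fun x => fderiv ℝ h x e, ← sub_eq_zero]
    refine eq_zero_of_mul_deriv_nonpos hs.1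
      (f := fun s =>
        sphereMean (fun x => fderiv ℝ h x e) s - sphereMean (fun x => fderiv ℝ h x e) 0)
      (fun x hx => (hasDerivAt_sphereMean_fderiv hh.1 e
        ⟨by linarith [hx.1], hx.2.trans_lt hs.2⟩).differentiableAt.hasDerivAt.sub_const _)
      (sub_self _) fun x hx => ?_
    rw [hh.deriv_sphereMean_fderiv_eq e ⟨hx.1, hx.2.trans hs.2⟩]
    simp
  have hcard : (1 : ℝ) ≤ Module.finrank ℝ E := by exact_mod_cast Module.finrank_pos
  rw [eq_comm, ← sub_eq_zero]
  refine eq_zero_of_mul_deriv_nonpos hr.1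
    (f := fun x => Module.finrank ℝ E * sphereMoment h e x - x * fderiv ℝ h 0 e)
    (fun x hx => ((hasDerivAt_sphereMoment hh₁ e (hsub hx)).differentiableAt.hasDerivAt.const_mul
      _).sub ((hasDerivAt_id x).mul_const _)) (by simp [sphereMoment_zero]) fun x hx => ?_
  have hode := mul_deriv_sphereMoment hh₁ e (hsub (Ioo_subset_Icc_self hx))
  rw [hmean ⟨hx.1.le, hx.2.trans hr.2⟩] at hode
  set n : ℝ := (Module.finrank ℝ E : ℝ)
  set d := n * sphereMoment h e x - x * fderiv ℝ h 0 e with hd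
  refine nonpos_of_mul_nonpos_right (a := x) ?_ hx.1
  calc x * (d * (n * deriv (sphereMoment h e) x - 1 * fderiv ℝ h 0 e))
      = -((n - 1) * d ^ 2) := by linear_combination n * d * hode + (n - 1) * d * hd
    _ ≤ 0 := neg_nonpos.2 (mul_nonneg (by linarith) (sq_nonneg _))

theorem hyperbolic_first_integral (hh : IsWeightedHarmonic (Module.finrank ℝ E - 2) h) (e : E)
    (hr : r ∈ Ico 0 1) :
    (1 - r ^ 2) * sphereMean (fun x => fderiv ℝ h x e) r
      + 2 * (Module.finrank ℝ E - 1) * r * sphereMoment h e r = fderiv ℝ h 0 e := by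
  have hh₁ : ContDiffOn ℝ 1 h (ball 0 1) := hh.1.of_le one_le_two
  have hsub {x : ℝ} (hx : x ∈ Icc 0 r) : x ∈ Ioo (-1) 1 :=
    ⟨by linarith [hx.1], hx.2.trans_lt hr.2⟩
  rw [← sub_eq_zero]
  refine eq_zero_of_mul_deriv_nonpos hr.1
    (f := fun x => (1 - x ^ 2) * sphereMean (fun x => fderiv ℝ h x e) x
      + 2 * (Module.finrank ℝ E - 1) * x * sphereMoment h e x - fderiv ℝ h 0 e)
    (fun x hx => (((((hasDerivAt_id x).pow 2).const_sub 1).mul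
      (hasDerivAt_sphereMean_fderiv hh.1 e (hsub hx)).differentiableAt.hasDerivAt).add
      (((hasDerivAt_id x).const_mul _).mul
        (hasDerivAt_sphereMoment hh₁ e (hsub hx)).differentiableAt.hasDerivAt)).sub_const _)
    (by simp [sphereMean_zero]) fun x hx => le_of_eq (mul_eq_zero_of_right _ ?_)
  have hode := mul_deriv_sphereMoment hh₁ e (hsub (Ioo_subset_Icc_self hx))
  have hx₁ : 1 - x ^ 2 ≠ 0 := by nlinarith [hx.1, hx.2, hr.2]
  simp only [hh.deriv_sphereMean_fderiv_eq e ⟨hx.1, hx.2.trans hr.2⟩, id, Pi.pow_apply]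
  field_simp
  linear_combination 2 * hode

theorem mul_fderiv_le_sphereMoment (hh : IsWeightedHarmonic (Module.finrank ℝ E - 2) h)
    (hE : 2 ≤ Module.finrank ℝ E) {e : E} (he : 0 ≤ fderiv ℝ h 0 e) (hr : r ∈ Ico 0 1) :
    r * fderiv ℝ h 0 e ≤ 2 * (Module.finrank ℝ E - 1) * sphereMoment h e r := by
  have hh₁ : ContDiffOn ℝ 1 h (ball 0 1) := hh.1.of_le one_le_two
  have hsub {x : ℝ} (hx : x ∈ Icc 0 r) : x ∈ Ioo (-1) 1 :=
    ⟨by linarith [hx.1], hx.2.trans_lt hr.2⟩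
  have hE' : (2 : ℝ) ≤ Module.finrank ℝ E := by exact_mod_cast hE
  rw [← sub_nonneg]
  refine nonneg_of_deriv_nonneg_of_neg hr.1
    (f := fun x => 2 * (Module.finrank ℝ E - 1) * sphereMoment h e x - x * fderiv ℝ h 0 e)
    (fun x hx => ((hasDerivAt_sphereMoment hh₁ e (hsub hx)).differentiableAt.hasDerivAt.const_mul
      _).sub ((hasDerivAt_id x).mul_const _)) (by simp [sphereMoment_zero]) fun x hx hneg => ?_
  have hode := mul_deriv_sphereMoment hh₁ e (hsub (Ioo_subset_Icc_self hx))
  have hint := hh.hyperbolic_first_integral e ⟨hx.1.le, hx.2.trans hr.2⟩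
  have hx₁ : 0 < 1 - x ^ 2 := by nlinarith [hx.1, hx.2, hr.2]
  set N : ℝ := (Module.finrank ℝ E : ℝ) - 1
  have hN : 1 ≤ N := by linarith
  set d := 2 * N * sphereMoment h e x - x * fderiv ℝ h 0 e with hd
  refine nonneg_of_mul_nonneg_right (a := x * (1 - x ^ 2)) ?_ (mul_pos hx.1 hx₁)
  calc 0 ≤ N * (1 + x ^ 2) * -d + x * fderiv ℝ h 0 e * (N - 1) * (1 - x ^ 2) := by
        have : 0 ≤ x * fderiv ℝ h 0 e := mul_nonneg hx.1.le he
        have : 0 ≤ -d := by linarith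
        have : 0 ≤ N - 1 := by linarith
        positivity
    _ = x * (1 - x ^ 2) * (2 * N * deriv (sphereMoment h e) x - 1 * fderiv ℝ h 0 e) := by
        linear_combination -2 * N * (1 - x ^ 2) * hode - 2 * N * x * hint - N * (1 + x ^ 2) * hd

theorem sphereMoment_le (hh : IsWeightedHarmonic β h) (hβ : 0 ≤ β)
    (hle : ∀ x ∈ ball (0 : E) 1, |h x| ≤ 1) (e : E) (hr : r ∈ Ico 0 1) :
    sphereMoment h e r ≤ ∫ ζ : sphere (0 : E) 1, |⟪e, ζ⟫_ℝ - -h 0| ∂sphereMeasure E - h 0 ^ 2 := by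
  have hmem (ζ : sphere (0 : E) 1) : r • (ζ : E) ∈ ball (0 : E) 1 :=
    smul_mem_ball_of_mem_sphere ⟨by linarith [hr.1], hr.2⟩ ζ.2
  have hbathtub := integral_inner_mul_le (φ := fun ζ => h (r • (ζ : E)))
    (hh.1.continuousOn.comp_continuous (by fun_prop) hmem) (fun ζ => hle _ (hmem ζ)) e (-h 0)
  have hmean : ∫ ζ : sphere (0 : E) 1, h (r • (ζ : E)) ∂sphereMeasure E = h 0 :=
    hh.sphereMean_eq hβ hr
  rw [hmean] at hbathtub
  rw [sphereMoment]
  linarith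

variable {κ : ℝ}

theorem norm_gradient_le_mul_integral (hh : IsWeightedHarmonic β h) (hβ : 0 ≤ β)
    (hle : ∀ x ∈ ball (0 : E) 1, |h x| ≤ 1) (hκ : 0 ≤ κ)
    (hmoment : ∀ e, 0 ≤ fderiv ℝ h 0 e → ∀ r ∈ Ico (0 : ℝ) 1,
      r * fderiv ℝ h 0 e ≤ κ * sphereMoment h e r) :
    ∃ e : E, ‖e‖ = 1 ∧ ‖gradient h 0‖ ≤
      κ * (∫ ζ : sphere (0 : E) 1, |⟪e, ζ⟫_ℝ - -h 0| ∂sphereMeasure E - h 0 ^ 2) := by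
  obtain ⟨e, he, hgrad⟩ := exists_norm_gradient_eq h 0
  refine ⟨e, he, le_of_tendsto (f := fun r : ℝ => r * ‖gradient h 0‖) (x := 𝓝[<] 1) ?_ ?_⟩
  · have : ContinuousAt (fun r : ℝ => r * ‖gradient h 0‖) 1 := by fun_prop
    simpa using this.tendsto.mono_left nhdsWithin_le_nhds
  · filter_upwards [Ico_mem_nhdsLT one_pos] with r hr
    rw [hgrad]
    exact (hmoment e (hgrad ▸ norm_nonneg _) r hr).trans
      (mul_le_mul_of_nonneg_left (hh.sphereMoment_le hβ hle e hr) hκ)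

theorem norm_gradient_le_of_sphereMoment (hE : 3 ≤ Module.finrank ℝ E)
    (hh : IsWeightedHarmonic β h) (hβ : 0 ≤ β) (hmaps : MapsTo h (ball 0 1) (Ioo (-1) 1))
    (hκ : 0 ≤ κ) (hmoment : ∀ e, 0 ≤ fderiv ℝ h 0 e → ∀ r ∈ Ico (0 : ℝ) 1,
      r * fderiv ℝ h 0 e ≤ κ * sphereMoment h e r) :
    ‖gradient h 0‖ ≤ κ / 2 * (1 - |h 0| ^ 2) := by
  obtain ⟨e, he, hgrad⟩ := hh.norm_gradient_le_mul_integral hβ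
    (fun x hx => (abs_lt.2 (hmaps hx)).le) hκ hmoment
  have hint := integral_abs_inner_sub_le hE he (neg_mem_Ioo_iff.2 (by
    simpa using hmaps (mem_ball_self one_pos)))
  rw [sq_abs]
  linarith [mul_le_mul_of_nonneg_left hint hκ]

theorem norm_gradient_lt_of_sphereMoment (hE : 4 ≤ Module.finrank ℝ E)
    (hh : IsWeightedHarmonic β h) (hβ : 0 ≤ β) (hmaps : MapsTo h (ball 0 1) (Ioo (-1) 1))
    (hκ : 0 < κ) (hmoment : ∀ e, 0 ≤ fderiv ℝ h 0 e → ∀ r ∈ Ico (0 : ℝ) 1,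
      r * fderiv ℝ h 0 e ≤ κ * sphereMoment h e r) :
    ‖gradient h 0‖ < κ / 2 * (1 - |h 0| ^ 2) := by
  obtain ⟨e, he, hgrad⟩ := hh.norm_gradient_le_mul_integral hβ
    (fun x hx => (abs_lt.2 (hmaps hx)).le) hκ.le hmoment
  have hint := integral_abs_inner_sub_lt hE he (neg_mem_Ioo_iff.2 (by
    simpa using hmaps (mem_ball_self one_pos)))
  rw [sq_abs]
  linarith [mul_lt_mul_of_pos_left hint hκ]

end IsWeightedHarmonic

end GradientBound

section Estimates

variable {E : Type*} [NormedAddCommGroup E] [InnerProductSpace ℝ E] [FiniteDimensional ℝ E]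
  {h : E → ℝ}

namespace IsWeightedHarmonic

theorem norm_gradient_le_of_harmonic (hE : 3 ≤ Module.finrank ℝ E) (hh : IsWeightedHarmonic 0 h)
    (hmaps : MapsTo h (ball 0 1) (Ioo (-1) 1)) :
    ‖gradient h 0‖ ≤ Module.finrank ℝ E / 2 * (1 - |h 0| ^ 2) := by
  borelize E
  have : Nontrivial E := Module.nontrivial_of_finrank_pos (R := ℝ) (by lia)
  exact hh.norm_gradient_le_of_sphereMoment hE le_rfl hmaps (by positivity)
    fun e _ r hr => (hh.mul_fderiv_eq_sphereMoment e hr).le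

theorem norm_gradient_lt_of_harmonic (hE : 4 ≤ Module.finrank ℝ E) (hh : IsWeightedHarmonic 0 h)
    (hmaps : MapsTo h (ball 0 1) (Ioo (-1) 1)) :
    ‖gradient h 0‖ < Module.finrank ℝ E / 2 * (1 - |h 0| ^ 2) := by
  borelize E
  have : Nontrivial E := Module.nontrivial_of_finrank_pos (R := ℝ) (by lia)
  have hpos : (0 : ℝ) < Module.finrank ℝ E := by exact_mod_cast (by lia : 0 < Module.finrank ℝ E)
  exact hh.norm_gradient_lt_of_sphereMoment hE le_rfl hmaps hpos
    fun e _ r hr => (hh.mul_fderiv_eq_sphereMoment e hr).le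

theorem norm_gradient_le_of_hyperbolicHarmonic (hE : 3 ≤ Module.finrank ℝ E)
    (hh : IsWeightedHarmonic (Module.finrank ℝ E - 2) h)
    (hmaps : MapsTo h (ball 0 1) (Ioo (-1) 1)) :
    ‖gradient h 0‖ ≤ (Module.finrank ℝ E - 1) * (1 - |h 0| ^ 2) := by
  borelize E
  have : Nontrivial E := Module.nontrivial_of_finrank_pos (R := ℝ) (by lia)
  have hdim : (3 : ℝ) ≤ Module.finrank ℝ E := by exact_mod_cast hE
  have hbound := hh.norm_gradient_le_of_sphereMoment hE (by linarith) hmaps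
    (κ := 2 * (Module.finrank ℝ E - 1)) (by linarith)
    fun e he r hr => hh.mul_fderiv_le_sphereMoment (by lia) he hr
  rwa [mul_div_cancel_left₀ _ two_ne_zero] at hbound

theorem norm_gradient_lt_of_hyperbolicHarmonic (hE : 4 ≤ Module.finrank ℝ E)
    (hh : IsWeightedHarmonic (Module.finrank ℝ E - 2) h)
    (hmaps : MapsTo h (ball 0 1) (Ioo (-1) 1)) :
    ‖gradient h 0‖ < (Module.finrank ℝ E - 1) * (1 - |h 0| ^ 2) := by
  borelize E
  have : Nontrivial E := Module.nontrivial_of_finrank_pos (R := ℝ) (by lia)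
  have hdim : (4 : ℝ) ≤ Module.finrank ℝ E := by exact_mod_cast hE
  have hbound := hh.norm_gradient_lt_of_sphereMoment hE (by linarith) hmaps
    (κ := 2 * (Module.finrank ℝ E - 1)) (by linarith)
    fun e he r hr => hh.mul_fderiv_le_sphereMoment (by lia) he hr
  rwa [mul_div_cancel_left₀ _ two_ne_zero] at hbound

end IsWeightedHarmonic

end Estimates

section LaplacianCalculus

variable {E : Type*} [NormedAddCommGroup E] [InnerProductSpace ℝ E]

theorem contDiffAt_norm_sub_sq (p x : E) : ContDiffAt ℝ 2 (fun y => ‖y - p‖ ^ 2) x :=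
  (ContDiff.norm_sq ℝ (contDiff_id.sub contDiff_const)).contDiffAt

theorem contDiffAt_norm_sub_sq_rpow {p x : E} (hxp : 0 < ‖x - p‖ ^ 2) (m : ℝ) :
    ContDiffAt ℝ 2 (fun y => (‖y - p‖ ^ 2) ^ m) x :=
  (contDiffAt_norm_sub_sq p x).rpow_const_of_ne hxp.ne'

theorem contDiffAt_const_sub_norm_sq (c : ℝ) (x : E) : ContDiffAt ℝ 2 (fun y => c - ‖y‖ ^ 2) x :=
  contDiffAt_const.sub (contDiff_norm_sq ℝ).contDiffAt

section Gradient

variable [CompleteSpace E] {f g : E → ℝ} {φ : ℝ → ℝ} {x : E}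

theorem gradient_mul (hf : DifferentiableAt ℝ f x) (hg : DifferentiableAt ℝ g x) :
    gradient (fun y => f y * g y) x = f x • gradient g x + g x • gradient f x := by
  simp [gradient, fderiv_fun_mul hf hg]

theorem gradient_comp (hφ : DifferentiableAt ℝ φ (f x)) (hf : DifferentiableAt ℝ f x) :
    gradient (fun y => φ (f y)) x = deriv φ (f x) • gradient f x := by
  have hfderiv : fderiv ℝ (fun y => φ (f y)) x = deriv φ (f x) • fderiv ℝ f x :=
    (hφ.hasDerivAt.comp_hasFDerivAt x hf.hasFDerivAt).fderiv
  simp [gradient, hfderiv]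

theorem gradient_norm_sub_sq (p x : E) : gradient (fun y => ‖y - p‖ ^ 2) x = (2 : ℝ) • (x - p) := by
  refine HasGradientAt.gradient (hasGradientAt_iff_hasFDerivAt.2 ?_)
  refine ((hasFDerivAt_id x).sub_const p).norm_sq.congr_fderiv ?_
  ext v
  simp [two_smul]

theorem gradient_norm_sub_sq_rpow {p : E} (hxp : 0 < ‖x - p‖ ^ 2) (m : ℝ) :
    gradient (fun y => (‖y - p‖ ^ 2) ^ m) x = (2 * m * (‖x - p‖ ^ 2) ^ (m - 1)) • (x - p) := by
  rw [gradient_comp (φ := fun t => t ^ m) (f := fun y : E => ‖y - p‖ ^ 2)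
    (Real.differentiableAt_rpow_const_of_ne _ hxp.ne')
    ((contDiffAt_norm_sub_sq p x).differentiableAt two_ne_zero),
    gradient_norm_sub_sq, Real.deriv_rpow_const, smul_smul]
  congr 1
  ring

theorem gradient_const_sub_norm_sq (c : ℝ) (x : E) :
    gradient (fun y => c - ‖y‖ ^ 2) x = -((2 : ℝ) • x) := by
  simpa [gradient, fderiv_const_sub] using congrArg Neg.neg (gradient_norm_sub_sq 0 x)

theorem gradient_inner_const (e x : E) : gradient (fun y => ⟪e, y⟫_ℝ) x = e :=
  HasGradientAt.gradient (hasGradientAt_iff_hasFDerivAt.2 (innerSL ℝ e).hasFDerivAt)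

theorem gradient_inv (hf : DifferentiableAt ℝ f x) (hfx : f x ≠ 0) :
    gradient (fun y => (f y)⁻¹) x = -((f x ^ 2)⁻¹ • gradient f x) := by
  rw [gradient_comp (φ := fun t => t⁻¹) (differentiableAt_inv hfx) hf, deriv_inv, neg_smul]

end Gradient

variable [FiniteDimensional ℝ E] {f g : E → ℝ} {φ : ℝ → ℝ} {x : E}

theorem inner_gradient_gradient {ι : Type*} [Fintype ι] (b : OrthonormalBasis ι ℝ E)
    (f g : E → ℝ) (x : E) :
    ⟪gradient f x, gradient g x⟫_ℝ = ∑ i, fderiv ℝ f x (b i) * fderiv ℝ g x (b i) := by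
  rw [← b.sum_inner_mul_inner]
  refine Finset.sum_congr rfl fun i _ => ?_
  rw [inner_gradient_left, real_inner_comm, inner_gradient_left]

theorem laplacian_mul (hf : ContDiffAt ℝ 2 f x) (hg : ContDiffAt ℝ 2 g x) :
    Laplacian.laplacian (fun y => f y * g y) x =
      f x * Laplacian.laplacian g x + 2 * ⟪gradient f x, gradient g x⟫_ℝ
        + g x * Laplacian.laplacian f x := by
  have hfderiv : fderiv ℝ (fun y => f y * g y) =ᶠ[𝓝 x]
      fun y => f y • fderiv ℝ g y + g y • fderiv ℝ f y := by
    filter_upwards [hf.eventually (by simp), hg.eventually (by simp)] with y hfy hgy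
    exact fderiv_fun_mul (hfy.differentiableAt two_ne_zero) (hgy.differentiableAt two_ne_zero)
  have hf' : DifferentiableAt ℝ (fderiv ℝ f) x :=
    (hf.fderiv_right (m := 1) le_rfl).differentiableAt one_ne_zero
  have hg' : DifferentiableAt ℝ (fderiv ℝ g) x :=
    (hg.fderiv_right (m := 1) le_rfl).differentiableAt one_ne_zero
  have hfderiv₂ := (((hf.differentiableAt two_ne_zero).hasFDerivAt.smul hg'.hasFDerivAt).add
    ((hg.differentiableAt two_ne_zero).hasFDerivAt.smul hf'.hasFDerivAt)).congr_of_eventuallyEq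
      hfderiv
  let b := stdOrthonormalBasis ℝ E
  simp only [laplacian_eq_sum_fderiv_fderiv b, inner_gradient_gradient b, hfderiv₂.fderiv,
    Finset.mul_sum, ← Finset.sum_add_distrib]
  refine Finset.sum_congr rfl fun i _ => ?_
  simp
  ring

theorem laplacian_comp (hφ : ContDiffAt ℝ 2 φ (f x)) (hf : ContDiffAt ℝ 2 f x) :
    Laplacian.laplacian (fun y => φ (f y)) x =
      deriv (deriv φ) (f x) * ‖gradient f x‖ ^ 2 + deriv φ (f x) * Laplacian.laplacian f x := by
  have hfderiv : fderiv ℝ (fun y => φ (f y)) =ᶠ[𝓝 x]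
      fun y => deriv φ (f y) • fderiv ℝ f y := by
    filter_upwards [hf.eventually (by simp),
      hf.continuousAt.eventually (hφ.eventually (by simp))] with y hfy hφy
    exact ((hφy.differentiableAt two_ne_zero).hasDerivAt.comp_hasFDerivAt y
      (hfy.differentiableAt two_ne_zero).hasFDerivAt).fderiv
  have hf' : DifferentiableAt ℝ (fderiv ℝ f) x :=
    (hf.fderiv_right (m := 1) le_rfl).differentiableAt one_ne_zero
  have hφ' : DifferentiableAt ℝ (deriv φ) (f x) :=
    (hφ.derivWithin (m := 1) le_rfl).differentiableAt one_ne_zero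
  have hfderiv₂ := ((hφ'.hasDerivAt.comp_hasFDerivAt x
    (hf.differentiableAt two_ne_zero).hasFDerivAt).smul hf'.hasFDerivAt).congr_of_eventuallyEq
      hfderiv
  let b := stdOrthonormalBasis ℝ E
  simp only [laplacian_eq_sum_fderiv_fderiv b, ← real_inner_self_eq_norm_sq,
    inner_gradient_gradient b, hfderiv₂.fderiv, Finset.mul_sum, ← Finset.sum_add_distrib]
  refine Finset.sum_congr rfl fun i _ => ?_
  simp
  ring

theorem laplacian_norm_sub_sq (p x : E) :
    Laplacian.laplacian (fun y => ‖y - p‖ ^ 2) x = 2 * Module.finrank ℝ E := by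
  have hfderiv : fderiv ℝ (fun y : E => ‖y - p‖ ^ 2) = fun y => (2 : ℝ) • innerSL ℝ (y - p) := by
    ext y v
    rw [← inner_gradient_left, gradient_norm_sub_sq, inner_smul_left]
    simp [inner_sub_left]
  have hfderiv₂ : HasFDerivAt (fun y : E => (2 : ℝ) • innerSL ℝ (y - p))
      ((2 : ℝ) • innerSL ℝ) x :=
    ((innerSL ℝ).hasFDerivAt.comp x ((hasFDerivAt_id x).sub_const p)).const_smul (2 : ℝ)
  let b := stdOrthonormalBasis ℝ E
  rw [laplacian_eq_sum_fderiv_fderiv b, hfderiv, hfderiv₂.fderiv]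
  change ∑ i, 2 * ⟪b i, b i⟫_ℝ = _
  simp [mul_comm]

theorem laplacian_norm_sub_sq_rpow {p : E} (hxp : 0 < ‖x - p‖ ^ 2) (m : ℝ) :
    Laplacian.laplacian (fun y => (‖y - p‖ ^ 2) ^ m) x =
      2 * m * (2 * m - 2 + Module.finrank ℝ E) * (‖x - p‖ ^ 2) ^ (m - 1) := by
  rw [laplacian_comp (φ := fun t => t ^ m) (f := fun y => ‖y - p‖ ^ 2)
    (Real.contDiffAt_rpow_const_of_ne hxp.ne')
    (contDiffAt_norm_sub_sq p x), laplacian_norm_sub_sq,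
    gradient_norm_sub_sq, Real.deriv_rpow_const', deriv_const_mul_field, Real.deriv_rpow_const,
    Real.rpow_sub_one hxp.ne' (m - 1), norm_smul, Real.norm_two, mul_pow]
  generalize ‖x - p‖ ^ 2 = B at *
  field

theorem laplacian_const_sub_norm_sq (c : ℝ) (x : E) :
    Laplacian.laplacian (fun y : E => c - ‖y‖ ^ 2) x = -(2 * Module.finrank ℝ E) := by
  rw [laplacian_comp (φ := fun t => c - t) (f := fun y : E => ‖y‖ ^ 2) (by fun_prop)
    (contDiff_norm_sq ℝ).contDiffAt]
  have hlaplacian := laplacian_norm_sub_sq 0 x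
  simp only [sub_zero] at hlaplacian
  simp [hlaplacian]

theorem laplacian_inner_const (e x : E) : Laplacian.laplacian (fun y => ⟪e, y⟫_ℝ) x = 0 := by
  have hfderiv : fderiv ℝ (fun y => ⟪e, y⟫_ℝ) = fun _ => innerSL ℝ e :=
    funext fun y => (innerSL ℝ e).hasFDerivAt.fderiv
  simp [laplacian_eq_sum_fderiv_fderiv (stdOrthonormalBasis ℝ E), hfderiv]

theorem laplacian_inv (hf : ContDiffAt ℝ 2 f x) (hfx : f x ≠ 0) :
    Laplacian.laplacian (fun y => (f y)⁻¹) x =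
      2 * ‖gradient f x‖ ^ 2 / f x ^ 3 - Laplacian.laplacian f x / f x ^ 2 := by
  have hderiv₂ : deriv (fun t : ℝ => -(t ^ 2)⁻¹) (f x) = 2 / f x ^ 3 := by
    rw [((hasDerivAt_pow 2 (f x)).fun_inv (pow_ne_zero 2 hfx)).fun_neg.deriv]
    field
  rw [laplacian_comp (φ := fun t => t⁻¹) (contDiffAt_inv ℝ hfx) hf, deriv_inv', hderiv₂]
  ring

end LaplacianCalculus

section Sharpness

variable {E : Type*} [NormedAddCommGroup E] [InnerProductSpace ℝ E] [FiniteDimensional ℝ E]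

theorem IsWeightedHarmonic.const_add_mul {β : ℝ} {u : E → ℝ} (hu : IsWeightedHarmonic β u)
    (a b : ℝ) : IsWeightedHarmonic β (fun x => a + b * u x) := by
  refine ⟨contDiffOn_const.add (contDiffOn_const.mul hu.1), fun x hx => ?_⟩
  have hux : ContDiffAt ℝ 2 u x := hu.1.contDiffAt (isOpen_ball.mem_nhds hx)
  have hlaplacian : Laplacian.laplacian (fun x => a + b * u x) x = b * Laplacian.laplacian u x := by
    have := laplacian_comp (φ := fun t => a + b * t) (by fun_prop) hux
    simpa using this
  have hfderiv : fderiv ℝ (fun x => a + b * u x) x = b • fderiv ℝ u x :=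
    (((hux.differentiableAt two_ne_zero).hasFDerivAt.const_mul b).const_add a).fderiv
  rw [hlaplacian, hfderiv, smul_apply, smul_eq_mul]
  linear_combination b * hu.2 x hx

/-- The constant `-1` is approached by `h = -1 + b u` as `b → 0`, and
`1 - h(0)² = 2 b u(0) - b² u(0)²`: the bound for `h` detects the logarithmic gradient of `u`. -/
theorem IsWeightedHarmonic.exists_norm_gradient_gt {β : ℝ} {u : E → ℝ}
    (hu : IsWeightedHarmonic β u) (hpos : ∀ x ∈ ball (0 : E) 1, 0 < u x)
    (hbdd : BddAbove (u '' ball 0 1)) {c : ℝ} (hgrad : 2 * c * u 0 < ‖gradient u 0‖) :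
    ∃ h : E → ℝ, IsWeightedHarmonic β h ∧ MapsTo h (ball 0 1) (Ioo (-1) 1) ∧
      c * (1 - |h 0| ^ 2) < ‖gradient h 0‖ := by
  have hzero : (0 : E) ∈ ball (0 : E) 1 := mem_ball_self one_pos
  obtain ⟨B, hB⟩ := hbdd
  replace hB (x : E) (hx : x ∈ ball 0 1) : u x ≤ B := hB (mem_image_of_mem u hx)
  have hBpos : 0 < B := (hpos 0 hzero).trans_le (hB 0 hzero)
  have hmaps : MapsTo (fun x => -1 + B⁻¹ * u x) (ball 0 1) (Ioo (-1) 1) := by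
    refine fun x hx => ⟨by linarith [mul_pos (inv_pos.2 hBpos) (hpos x hx)], ?_⟩
    have : B⁻¹ * u x ≤ 1 := (inv_mul_le_one₀ hBpos).2 (hB x hx)
    linarith
  have hgradient : ‖gradient (fun x => -1 + B⁻¹ * u x) 0‖ = B⁻¹ * ‖gradient u 0‖ := by
    rw [gradient_comp (φ := fun t => -1 + B⁻¹ * t) (by fun_prop)
      ((hu.1.contDiffAt (ball_mem_nhds 0 one_pos)).differentiableAt two_ne_zero), norm_smul]
    simp [abs_of_pos hBpos]
  refine ⟨fun x => -1 + B⁻¹ * u x, hu.const_add_mul _ _, hmaps, ?_⟩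
  rcases lt_or_ge c 0 with hc | hc
  · refine (mul_neg_of_neg_of_pos hc ?_).trans_le (norm_nonneg _)
    have := abs_lt.2 (hmaps hzero)
    nlinarith [abs_nonneg (-1 + B⁻¹ * u 0)]
  · calc c * (1 - |-1 + B⁻¹ * u 0| ^ 2) = B⁻¹ * (2 * c * u 0) - c * (B⁻¹ * u 0) ^ 2 := by
          rw [sq_abs]
          ring
      _ ≤ B⁻¹ * (2 * c * u 0) := sub_le_self _ (by positivity)
      _ < B⁻¹ * ‖gradient u 0‖ := mul_lt_mul_of_pos_left hgrad (inv_pos.2 hBpos)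
      _ = _ := hgradient.symm

end Sharpness

section PoissonKernel

variable {E : Type*} [NormedAddCommGroup E] {p x : E}

theorem norm_sub_sq_pos_of_mem_closedBall (hp : 1 < ‖p‖)
    (hx : x ∈ closedBall (0 : E) 1) : 0 < ‖x - p‖ ^ 2 := by
  refine pow_pos (norm_pos_iff.2 (sub_ne_zero.2 ?_)) 2
  rintro rfl
  exact (mem_closedBall_zero_iff.1 hx).not_gt hp

variable [InnerProductSpace ℝ E]

/-- The Poisson kernel of the ball of radius `‖p‖` with pole `p`, up to a constant factor. -/
noncomputable def ballPoissonKernel (p x : E) : ℝ :=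
  (‖p‖ ^ 2 - ‖x‖ ^ 2) * (‖x - p‖ ^ 2) ^ (-(Module.finrank ℝ E : ℝ) / 2)

theorem ballPoissonKernel_pos (hp : 1 < ‖p‖) (hx : x ∈ closedBall (0 : E) 1) :
    0 < ballPoissonKernel p x := by
  refine mul_pos ?_ (Real.rpow_pos_of_pos (norm_sub_sq_pos_of_mem_closedBall hp hx) _)
  rw [mem_closedBall_zero_iff] at hx
  nlinarith [norm_nonneg x]

variable [FiniteDimensional ℝ E]

theorem isWeightedHarmonic_ballPoissonKernel (hp : 1 < ‖p‖) :
    IsWeightedHarmonic 0 (ballPoissonKernel p) := by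
  have hsub {x : E} (hx : x ∈ ball (0 : E) 1) : 0 < ‖x - p‖ ^ 2 :=
    norm_sub_sq_pos_of_mem_closedBall hp (ball_subset_closedBall hx)
  refine ⟨fun x hx => ?_, fun x hx => ?_⟩
  · exact ((contDiffAt_const_sub_norm_sq _ x).mul
      (contDiffAt_norm_sub_sq_rpow (hsub hx) _)).contDiffWithinAt
  · have hxp := hsub hx
    have hinner : 2 * ⟪x, x - p⟫_ℝ = ‖x‖ ^ 2 - ‖p‖ ^ 2 + ‖x - p‖ ^ 2 := by
      rw [norm_sub_sq_real, inner_sub_right, real_inner_self_eq_norm_sq]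
      ring
    have hlaplacian : Laplacian.laplacian (ballPoissonKernel p) x = 0 := by
      unfold ballPoissonKernel
      rw [laplacian_mul (contDiffAt_const_sub_norm_sq _ x) (contDiffAt_norm_sub_sq_rpow hxp _),
        laplacian_norm_sub_sq_rpow hxp, gradient_norm_sub_sq_rpow hxp, gradient_const_sub_norm_sq,
        laplacian_const_sub_norm_sq, inner_neg_left, inner_smul_left, inner_smul_right,
        conj_trivial, Real.rpow_sub_one hxp.ne']
      generalize (‖x - p‖ ^ 2) ^ (-(Module.finrank ℝ E : ℝ) / 2) = R
      generalize ‖x - p‖ ^ 2 = B at *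
      field_simp
      linear_combination 2 * Module.finrank ℝ E * R * hinner
    rw [hlaplacian]
    ring

theorem bddAbove_ballPoissonKernel (hp : 1 < ‖p‖) :
    BddAbove (ballPoissonKernel p '' ball 0 1) := by
  refine ((isCompact_closedBall (0 : E) 1).bddAbove_image fun x hx => ?_).mono
    (image_mono ball_subset_closedBall)
  exact ((contDiffAt_const_sub_norm_sq _ x).mul (contDiffAt_norm_sub_sq_rpow
    (norm_sub_sq_pos_of_mem_closedBall hp hx) _)).continuousAt.continuousWithinAt

theorem norm_gradient_ballPoissonKernel_zero (hp : p ≠ 0) :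
    ‖gradient (ballPoissonKernel p) 0‖ =
      Module.finrank ℝ E * ‖ballPoissonKernel p 0‖ / ‖p‖ := by
  have : 0 < ‖p‖ := norm_pos_iff.2 hp
  have hxp : 0 < ‖0 - p‖ ^ 2 := by
    rw [zero_sub, norm_neg]
    positivity
  have hgradient : gradient (ballPoissonKernel p) 0 =
      (Module.finrank ℝ E * ballPoissonKernel p 0 / ‖p‖ ^ 2) • p := by
    unfold ballPoissonKernel
    rw [gradient_mul ((contDiffAt_const_sub_norm_sq _ 0).differentiableAt two_ne_zero)
      ((contDiffAt_norm_sub_sq_rpow hxp _).differentiableAt two_ne_zero),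
      gradient_norm_sub_sq_rpow hxp, gradient_const_sub_norm_sq, Real.rpow_sub_one hxp.ne',
      smul_zero, neg_zero, smul_zero, add_zero, zero_sub, norm_neg, smul_neg, ← neg_smul,
      smul_smul, norm_zero]
    congr 1
    field
  rw [hgradient, norm_smul, norm_div, norm_mul, norm_pow, norm_norm, Real.norm_natCast]
  field

theorem exists_harmonic_norm_gradient_gt [Nontrivial E] {c : ℝ} (hc : c < Module.finrank ℝ E / 2) :
    ∃ h : E → ℝ, IsWeightedHarmonic 0 h ∧ MapsTo h (ball 0 1) (Ioo (-1) 1) ∧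
      c * (1 - |h 0| ^ 2) < ‖gradient h 0‖ := by
  obtain ⟨ρ, hρ, hρc⟩ : ∃ ρ : ℝ, 1 < ρ ∧ 2 * c * ρ < Module.finrank ℝ E := by
    have hlim : ContinuousAt (fun ρ : ℝ => 2 * c * ρ) 1 := by fun_prop
    exact ((eventually_mem_nhdsWithin (a := 1) (s := Ioi 1)).and
      ((hlim.eventually_lt_const (by linarith)).filter_mono nhdsWithin_le_nhds)).exists
  obtain ⟨p, hp⟩ := exists_norm_eq E (zero_le_one.trans hρ.le)
  rw [← hp] at hρ hρc
  have hpos (x : E) (hx : x ∈ ball 0 1) : 0 < ballPoissonKernel p x :=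
    ballPoissonKernel_pos hρ (ball_subset_closedBall hx)
  have hzero : 0 < ballPoissonKernel p 0 := hpos 0 (mem_ball_self one_pos)
  refine (isWeightedHarmonic_ballPoissonKernel hρ).exists_norm_gradient_gt hpos
    (bddAbove_ballPoissonKernel hρ) ?_
  rw [norm_gradient_ballPoissonKernel_zero (norm_pos_iff.1 (by linarith)),
    Real.norm_of_nonneg hzero.le, lt_div_iff₀ (by linarith)]
  linarith [mul_lt_mul_of_pos_right hρc hzero]

end PoissonKernel

section HyperbolicDistance

variable {E : Type*} [NormedAddCommGroup E] [InnerProductSpace ℝ E] {d : ℝ} {e x : E}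

/-- In the ball model of curvature `-1`, the hyperbolic sine of the signed distance from `x` to the
hyperplane that is orthogonal to the diameter along the unit vector `e` and lies at distance `d`
from the origin. -/
noncomputable def sinhDistHyperplane (d : ℝ) (e x : E) : ℝ :=
  Real.sinh d + 2 * ((Real.cosh d * ⟪e, x⟫_ℝ - Real.sinh d) * (1 - ‖x‖ ^ 2)⁻¹)

theorem sinhDistHyperplane_zero (d : ℝ) (e : E) : sinhDistHyperplane d e 0 = -Real.sinh d := by
  simp [sinhDistHyperplane]
  ring

theorem contDiffAt_const_mul_inner_sub (a b : ℝ) (e x : E) :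
    ContDiffAt ℝ 2 (fun y => a * ⟪e, y⟫_ℝ - b) x :=
  (contDiffAt_const.mul (innerSL ℝ e).contDiff.contDiffAt).sub contDiffAt_const

theorem contDiffAt_inv_one_sub_norm_sq (hx : x ∈ ball (0 : E) 1) :
    ContDiffAt ℝ 2 (fun y => (1 - ‖y‖ ^ 2)⁻¹) x :=
  (contDiffAt_const_sub_norm_sq 1 x).inv (one_sub_norm_sq_pos hx).ne'

theorem contDiffAt_sinhDistHyperplane (d : ℝ) (e : E) (hx : x ∈ ball (0 : E) 1) :
    ContDiffAt ℝ 2 (sinhDistHyperplane d e) x :=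
  contDiffAt_const.add (contDiffAt_const.mul
    ((contDiffAt_const_mul_inner_sub _ _ e x).mul (contDiffAt_inv_one_sub_norm_sq hx)))

theorem gradient_const_mul_inner_sub [CompleteSpace E] (a b : ℝ) (e x : E) :
    gradient (fun y => a * ⟪e, y⟫_ℝ - b) x = a • e := by
  rw [gradient_comp (f := fun y => ⟪e, y⟫_ℝ) (φ := fun t => a * t - b) (by fun_prop)
    (innerSL ℝ e).differentiableAt, gradient_inner_const]
  simp

theorem gradient_sinhDistHyperplane [CompleteSpace E] (d : ℝ) (e : E) (hx : x ∈ ball (0 : E) 1) :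
    gradient (sinhDistHyperplane d e) x = (2 * Real.cosh d / (1 - ‖x‖ ^ 2)) • e
      + (4 * (Real.cosh d * ⟪e, x⟫_ℝ - Real.sinh d) / (1 - ‖x‖ ^ 2) ^ 2) • x := by
  have hA := contDiffAt_const_mul_inner_sub (Real.cosh d) (Real.sinh d) e x
  have hs := contDiffAt_inv_one_sub_norm_sq hx
  unfold sinhDistHyperplane
  rw [gradient_comp (φ := fun t => Real.sinh d + 2 * t) (by fun_prop)
      ((hA.mul hs).differentiableAt two_ne_zero),
    gradient_mul (hA.differentiableAt two_ne_zero) (hs.differentiableAt two_ne_zero),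
    gradient_const_mul_inner_sub,
    gradient_inv ((contDiffAt_const_sub_norm_sq 1 x).differentiableAt two_ne_zero)
      (one_sub_norm_sq_pos hx).ne',
    gradient_const_sub_norm_sq]
  have hderiv : deriv (fun t : ℝ => Real.sinh d + 2 * t)
    ((Real.cosh d * ⟪e, x⟫_ℝ - Real.sinh d) * (1 - ‖x‖ ^ 2)⁻¹) = 2 := by simp
  rw [hderiv]
  module

theorem norm_gradient_sinhDistHyperplane_sq [CompleteSpace E] (d : ℝ) (he : ‖e‖ = 1)
    (hx : x ∈ ball (0 : E) 1) :
    (1 - ‖x‖ ^ 2) ^ 2 * ‖gradient (sinhDistHyperplane d e) x‖ ^ 2 =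
      4 * (1 + sinhDistHyperplane d e x ^ 2) := by
  have hs := one_sub_norm_sq_pos hx
  rw [gradient_sinhDistHyperplane d e hx, sinhDistHyperplane, norm_add_sq_real, inner_smul_left,
    inner_smul_right, conj_trivial, norm_smul, norm_smul, mul_pow, mul_pow, he, Real.norm_eq_abs,
    Real.norm_eq_abs, sq_abs, sq_abs]
  field_simp
  linear_combination 4 * (1 - ‖x‖ ^ 2) ^ 2 * Real.cosh_sq d

variable [FiniteDimensional ℝ E]

theorem laplacian_sinhDistHyperplane (d : ℝ) (e : E) (hx : x ∈ ball (0 : E) 1) :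
    (1 - ‖x‖ ^ 2) ^ 2 * Laplacian.laplacian (sinhDistHyperplane d e) x
      + 2 * (Module.finrank ℝ E - 2) * (1 - ‖x‖ ^ 2) * ⟪gradient (sinhDistHyperplane d e) x, x⟫_ℝ =
      4 * Module.finrank ℝ E * sinhDistHyperplane d e x := by
  have hs := one_sub_norm_sq_pos hx
  have hA := contDiffAt_const_mul_inner_sub (Real.cosh d) (Real.sinh d) e x
  have hlaplacianA :
      Laplacian.laplacian (fun y => Real.cosh d * ⟪e, y⟫_ℝ - Real.sinh d) x = 0 := by
    rw [laplacian_comp (f := fun y => ⟪e, y⟫_ℝ) (φ := fun t => Real.cosh d * t - Real.sinh d)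
      (by fun_prop) (innerSL ℝ e).contDiff.contDiffAt, laplacian_inner_const]
    simp
  have hlaplacian : Laplacian.laplacian (sinhDistHyperplane d e) x =
      2 * Laplacian.laplacian
        (fun y => (Real.cosh d * ⟪e, y⟫_ℝ - Real.sinh d) * (1 - ‖y‖ ^ 2)⁻¹) x := by
    unfold sinhDistHyperplane
    rw [laplacian_comp (φ := fun t => Real.sinh d + 2 * t) (by fun_prop)
      (hA.mul (contDiffAt_inv_one_sub_norm_sq hx))]
    simp
  rw [hlaplacian, laplacian_mul hA (contDiffAt_inv_one_sub_norm_sq hx), hlaplacianA,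
    laplacian_inv (contDiffAt_const_sub_norm_sq 1 x) hs.ne', gradient_const_mul_inner_sub,
    gradient_inv ((contDiffAt_const_sub_norm_sq 1 x).differentiableAt two_ne_zero) hs.ne',
    gradient_const_sub_norm_sq, laplacian_const_sub_norm_sq, gradient_sinhDistHyperplane d e hx,
    sinhDistHyperplane]
  simp only [inner_add_left, inner_smul_left, inner_smul_right, inner_neg_right, conj_trivial,
    norm_neg, norm_smul, Real.norm_two, real_inner_self_eq_norm_sq]
  field_simp
  ring

end HyperbolicDistance

section JapanesePrimitive

variable {ν : ℝ}

/-- The primitive that vanishes at `-∞` of the power `-ν` of the Japanese bracket `√(1 + t²)`. -/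
noncomputable def japanesePrimitive (ν y : ℝ) : ℝ := ∫ t in Iic y, (1 + t ^ 2) ^ (-ν / 2)

theorem one_add_sq_rpow_pos (t m : ℝ) : 0 < (1 + t ^ 2) ^ m :=
  Real.rpow_pos_of_pos (by positivity) m

theorem contDiff_one_add_sq_rpow {k : WithTop ℕ∞} (m : ℝ) :
    ContDiff ℝ k fun t : ℝ => (1 + t ^ 2) ^ m :=
  ContDiff.rpow_const_of_ne (by fun_prop) fun t => by positivity

theorem integrable_one_add_sq_rpow (hν : 1 < ν) :
    Integrable fun t : ℝ => (1 + t ^ 2) ^ (-ν / 2) := by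
  simpa using
    integrable_rpow_neg_one_add_norm_sq (E := ℝ) (μ := volume) (r := ν) (by simpa using hν)

theorem hasDerivAt_japanesePrimitive (hν : 1 < ν) (y : ℝ) :
    HasDerivAt (japanesePrimitive ν) ((1 + y ^ 2) ^ (-ν / 2)) y := by
  have hprimitive : japanesePrimitive ν = fun y =>
      japanesePrimitive ν 0 + ∫ t in (0 : ℝ)..y, (1 + t ^ 2) ^ (-ν / 2) := by
    ext y
    rw [← intervalIntegral.integral_Iic_sub_Iic (integrable_one_add_sq_rpow hν).integrableOn
      (integrable_one_add_sq_rpow hν).integrableOn]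
    exact (add_sub_cancel _ _).symm
  rw [hprimitive]
  exact ((contDiff_one_add_sq_rpow (k := 0) (-ν / 2)).continuous.integral_hasStrictDerivAt
    0 y).hasDerivAt.const_add _

theorem deriv_japanesePrimitive (hν : 1 < ν) :
    deriv (japanesePrimitive ν) = fun t => (1 + t ^ 2) ^ (-ν / 2) :=
  funext fun y => (hasDerivAt_japanesePrimitive hν y).deriv

theorem deriv_deriv_japanesePrimitive (hν : 1 < ν) (y : ℝ) :
    (1 + y ^ 2) * deriv (deriv (japanesePrimitive ν)) y =
      -ν * y * deriv (japanesePrimitive ν) y := by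
  have hpos : 0 < 1 + y ^ 2 := by positivity
  have hderiv : HasDerivAt (fun t : ℝ => (1 + t ^ 2) ^ (-ν / 2))
      (2 * y * (-ν / 2) * (1 + y ^ 2) ^ (-ν / 2 - 1)) y :=
    (((hasDerivAt_pow 2 y).const_add 1).rpow_const (Or.inl hpos.ne')).congr_deriv (by simp)
  rw [deriv_japanesePrimitive hν, hderiv.deriv, Real.rpow_sub_one hpos.ne']
  field

theorem contDiff_japanesePrimitive (hν : 1 < ν) : ContDiff ℝ 2 (japanesePrimitive ν) := by
  rw [show (2 : WithTop ℕ∞) = 1 + 1 by norm_num, contDiff_succ_iff_deriv,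
    deriv_japanesePrimitive hν]
  exact ⟨fun y => (hasDerivAt_japanesePrimitive hν y).differentiableAt, by simp,
    contDiff_one_add_sq_rpow _⟩

theorem japanesePrimitive_pos (hν : 1 < ν) (y : ℝ) : 0 < japanesePrimitive ν y := by
  have hsupport : (Function.support fun t : ℝ => (1 + t ^ 2) ^ (-ν / 2)) = univ :=
    eq_univ_of_forall fun t => (one_add_sq_rpow_pos t _).ne'
  rw [japanesePrimitive, integral_pos_iff_support_of_nonneg
    (fun t => (one_add_sq_rpow_pos t _).le) (integrable_one_add_sq_rpow hν).integrableOn, hsupport]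
  simp

theorem japanesePrimitive_le_integral (hν : 1 < ν) (y : ℝ) :
    japanesePrimitive ν y ≤ ∫ t : ℝ, (1 + t ^ 2) ^ (-ν / 2) :=
  setIntegral_le_integral (integrable_one_add_sq_rpow hν)
    (Eventually.of_forall fun t => (one_add_sq_rpow_pos t _).le)

theorem japanesePrimitive_neg_le (hν : 1 < ν) {a : ℝ} (ha : 0 < a) :
    japanesePrimitive ν (-a) ≤ a ^ (1 - ν) / (ν - 1) := by
  have hreflect : japanesePrimitive ν (-a) = ∫ t in Ioi a, (1 + t ^ 2) ^ (-ν / 2) := by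
    have hneg := integral_comp_neg_Iic (-a) (fun t : ℝ => (1 + t ^ 2) ^ (-ν / 2))
    simpa only [japanesePrimitive, neg_sq, neg_neg] using hneg
  have htail : ∫ t in Ioi a, t ^ (-ν) = a ^ (1 - ν) / (ν - 1) := by
    rw [integral_Ioi_rpow_of_lt (by linarith) ha, neg_add_eq_sub, ← neg_sub ν 1, neg_div_neg_eq]
  rw [hreflect, ← htail]
  refine setIntegral_mono_on (integrable_one_add_sq_rpow hν).integrableOn
    (integrableOn_Ioi_rpow_of_lt (by linarith) ha) measurableSet_Ioi fun t ht => ?_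
  have htpos : 0 < t := ha.trans ht
  calc (1 + t ^ 2) ^ (-ν / 2) ≤ (t ^ 2) ^ (-ν / 2) :=
        Real.rpow_le_rpow_of_nonpos (by positivity) (by linarith) (by linarith)
    _ = t ^ (-ν) := by
        rw [← Real.rpow_natCast_mul htpos.le]
        congr 1
        push_cast
        ring

theorem mul_japanesePrimitive_neg_sinh_le (hν : 1 < ν) {d : ℝ} (hd : 0 < d) :
    (ν - 1) * Real.tanh d ^ (ν - 1) * japanesePrimitive ν (-Real.sinh d) ≤
      Real.cosh d ^ (1 - ν) := by
  have hsinh : 0 < Real.sinh d := Real.sinh_pos_iff.2 hd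
  have hcosh : 0 < Real.cosh d := Real.cosh_pos d
  have htanh : Real.tanh d ^ (ν - 1) = Real.sinh d ^ (ν - 1) * Real.cosh d ^ (1 - ν) := by
    rw [Real.tanh_eq_sinh_div_cosh, Real.div_rpow hsinh.le hcosh.le, div_eq_mul_inv,
      ← Real.rpow_neg hcosh.le, neg_sub]
  have hcancel : Real.sinh d ^ (ν - 1) * Real.sinh d ^ (1 - ν) = 1 := by
    rw [← Real.rpow_add hsinh, sub_add_sub_cancel, sub_self, Real.rpow_zero]
  have hν' : 0 < ν - 1 := sub_pos.2 hν
  rw [htanh]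
  calc (ν - 1) * (Real.sinh d ^ (ν - 1) * Real.cosh d ^ (1 - ν)) *
          japanesePrimitive ν (-Real.sinh d)
      ≤ (ν - 1) * (Real.sinh d ^ (ν - 1) * Real.cosh d ^ (1 - ν)) *
          (Real.sinh d ^ (1 - ν) / (ν - 1)) := by
        gcongr
        exact japanesePrimitive_neg_le hν hsinh
    _ = Real.sinh d ^ (ν - 1) * Real.sinh d ^ (1 - ν) * Real.cosh d ^ (1 - ν) := by
        field
    _ = Real.cosh d ^ (1 - ν) := by rw [hcancel, one_mul]

end JapanesePrimitive

section HyperbolicHarmonicMeasure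

variable {E : Type*} [NormedAddCommGroup E] [InnerProductSpace ℝ E] [FiniteDimensional ℝ E]
  {d : ℝ} {e : E}

/-- A function `φ` of `w = sinhDistHyperplane d e` is hyperbolic harmonic as soon as
`(1 + w²) φ''(w) + n w φ'(w) = 0`. -/
theorem isWeightedHarmonic_japanesePrimitive_comp (hE : 2 ≤ Module.finrank ℝ E) (d : ℝ)
    (he : ‖e‖ = 1) :
    IsWeightedHarmonic (Module.finrank ℝ E - 2)
      (japanesePrimitive (Module.finrank ℝ E) ∘ sinhDistHyperplane d e) := by
  have hn : (1 : ℝ) < Module.finrank ℝ E := by exact_mod_cast hE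
  have hφ := contDiff_japanesePrimitive hn
  refine ⟨fun x hx => ((hφ.contDiffAt).comp x
    (contDiffAt_sinhDistHyperplane d e hx)).contDiffWithinAt, fun x hx => ?_⟩
  have hw := contDiffAt_sinhDistHyperplane d e hx
  have hs := one_sub_norm_sq_pos hx
  rw [← inner_gradient_left, Function.comp_def, gradient_comp (hφ.differentiable two_ne_zero _)
    (hw.differentiableAt two_ne_zero), laplacian_comp hφ.contDiffAt hw, inner_smul_left,
    conj_trivial]
  refine mul_left_cancel₀ hs.ne' ?_
  linear_combination
    deriv (deriv (japanesePrimitive (Module.finrank ℝ E))) (sinhDistHyperplane d e x) *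
      norm_gradient_sinhDistHyperplane_sq d he hx +
    deriv (japanesePrimitive (Module.finrank ℝ E)) (sinhDistHyperplane d e x) *
      laplacian_sinhDistHyperplane d e hx +
    4 * deriv_deriv_japanesePrimitive hn (sinhDistHyperplane d e x)

theorem norm_gradient_japanesePrimitive_comp_zero {ν : ℝ} (hν : 1 < ν) (d : ℝ) (he : ‖e‖ = 1) :
    ‖gradient (japanesePrimitive ν ∘ sinhDistHyperplane d e) 0‖ = 2 * Real.cosh d ^ (1 - ν) := by
  have hzero : (0 : E) ∈ ball (0 : E) 1 := mem_ball_self one_pos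
  have hcosh := Real.cosh_pos d
  have hpow : (Real.cosh d ^ 2) ^ (-ν / 2) * Real.cosh d = Real.cosh d ^ (1 - ν) := by
    rw [← Real.rpow_natCast_mul hcosh.le, ← Real.rpow_add_one hcosh.ne']
    congr 1
    push_cast
    ring
  rw [Function.comp_def, gradient_comp (hasDerivAt_japanesePrimitive hν _).differentiableAt
    ((contDiffAt_sinhDistHyperplane d e hzero).differentiableAt two_ne_zero),
    (hasDerivAt_japanesePrimitive hν _).deriv, gradient_sinhDistHyperplane d e hzero,
    sinhDistHyperplane_zero, neg_sq, add_comm 1, ← Real.cosh_sq, smul_zero, add_zero, norm_zero,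
    norm_smul, norm_smul, he, ← hpow, Real.norm_of_nonneg (by positivity),
    Real.norm_of_nonneg (by positivity)]
  ring

theorem exists_hyperbolicHarmonic_norm_gradient_gt (hE : 2 ≤ Module.finrank ℝ E) {c : ℝ}
    (hc : c < Module.finrank ℝ E - 1) :
    ∃ h : E → ℝ, IsWeightedHarmonic (Module.finrank ℝ E - 2) h ∧
      MapsTo h (ball 0 1) (Ioo (-1) 1) ∧ c * (1 - |h 0| ^ 2) < ‖gradient h 0‖ := by
  have hn : (1 : ℝ) < Module.finrank ℝ E := by exact_mod_cast hE
  have : Nontrivial E := Module.nontrivial_of_finrank_pos (R := ℝ) (by omega)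
  obtain ⟨e, he⟩ := exists_norm_eq E (zero_le_one' ℝ)
  obtain ⟨T, hT, hTc⟩ : ∃ T ∈ Ioo (0 : ℝ) 1,
      c < (Module.finrank ℝ E - 1) * T ^ ((Module.finrank ℝ E : ℝ) - 1) := by
    have hlim : ContinuousAt (fun T : ℝ => (Module.finrank ℝ E - 1) *
        T ^ ((Module.finrank ℝ E : ℝ) - 1)) 1 :=
      continuousAt_const.mul (Real.continuousAt_rpow_const _ _ (Or.inl one_ne_zero))
    exact ((eventually_mem_set.2 (Ioo_mem_nhdsLT one_pos)).and
      ((hlim.eventually_const_lt (by simpa using hc)).filter_mono nhdsWithin_le_nhds)).exists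
  obtain ⟨d, hd, rfl⟩ : ∃ d, 0 < d ∧ Real.tanh d = T :=
    ⟨Real.artanh T, Real.artanh_pos hT, Real.tanh_artanh ⟨by linarith [hT.1], hT.2⟩⟩
  refine (isWeightedHarmonic_japanesePrimitive_comp hE d he).exists_norm_gradient_gt
    (fun x _ => japanesePrimitive_pos hn _)
    ⟨_, forall_mem_image.2 fun x _ => japanesePrimitive_le_integral hn _⟩ ?_
  rw [norm_gradient_japanesePrimitive_comp_zero hn d he, Function.comp_apply,
    sinhDistHyperplane_zero, mul_assoc]
  gcongr
  exact (mul_lt_mul_of_pos_right hTc (japanesePrimitive_pos hn _)).trans_le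
    (mul_japanesePrimitive_neg_sinh_le hn hd)

end HyperbolicHarmonicMeasure

theorem mainTheorem4_general {E : Type*} [NormedAddCommGroup E] [InnerProductSpace ℝ E]
    [FiniteDimensional ℝ E] (hE : 3 ≤ Module.finrank ℝ E) :
    ((∀ h : E → ℝ, IsWeightedHarmonic 0 h → MapsTo h (ball 0 1) (Ioo (-1) 1) →
        ‖gradient h 0‖ ≤ Module.finrank ℝ E / 2 * (1 - |h 0| ^ 2) ∧
        (4 ≤ Module.finrank ℝ E →
          ‖gradient h 0‖ < Module.finrank ℝ E / 2 * (1 - |h 0| ^ 2))) ∧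
      (∀ c : ℝ, c < Module.finrank ℝ E / 2 → ∃ h : E → ℝ, IsWeightedHarmonic 0 h ∧
        MapsTo h (ball 0 1) (Ioo (-1) 1) ∧ c * (1 - |h 0| ^ 2) < ‖gradient h 0‖)) ∧
    ((∀ h : E → ℝ, IsWeightedHarmonic (Module.finrank ℝ E - 2) h →
        MapsTo h (ball 0 1) (Ioo (-1) 1) →
          ‖gradient h 0‖ ≤ (Module.finrank ℝ E - 1) * (1 - |h 0| ^ 2) ∧
          (4 ≤ Module.finrank ℝ E →
            ‖gradient h 0‖ < (Module.finrank ℝ E - 1) * (1 - |h 0| ^ 2))) ∧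
      (∀ c : ℝ, c < Module.finrank ℝ E - 1 → ∃ h : E → ℝ,
        IsWeightedHarmonic (Module.finrank ℝ E - 2) h ∧
          MapsTo h (ball 0 1) (Ioo (-1) 1) ∧ c * (1 - |h 0| ^ 2) < ‖gradient h 0‖)) := by
  have : Nontrivial E := Module.nontrivial_of_finrank_pos (R := ℝ) (by lia)
  exact ⟨⟨fun h hh hmaps => ⟨hh.norm_gradient_le_of_harmonic hE hmaps,
        fun hE₄ => hh.norm_gradient_lt_of_harmonic hE₄ hmaps⟩,
      fun c hc => exists_harmonic_norm_gradient_gt hc⟩,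
    ⟨fun h hh hmaps => ⟨hh.norm_gradient_le_of_hyperbolicHarmonic hE hmaps,
        fun hE₄ => hh.norm_gradient_lt_of_hyperbolicHarmonic hE₄ hmaps⟩,
      fun c hc => exists_hyperbolicHarmonic_norm_gradient_gt (by lia) hc⟩⟩

section EuclideanSpace

variable {n : ℕ}

theorem sum_mul_fderiv_single (u : EuclideanSpace ℝ (Fin n) → ℝ) (x : EuclideanSpace ℝ (Fin n)) :
    ∑ i : Fin n, x i * fderiv ℝ u x (EuclideanSpace.single i (1 : ℝ)) = fderiv ℝ u x x := by
  simpa only [map_sum, map_smul, smul_eq_mul, EuclideanSpace.basisFun_repr,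
    EuclideanSpace.basisFun_apply] using
    congrArg (fderiv ℝ u x) ((EuclideanSpace.basisFun (Fin n) ℝ).sum_repr x)

theorem isHarmonic_iff_isWeightedHarmonic {h : EuclideanSpace ℝ (Fin n) → ℝ} :
    IsHarmonic h ↔ IsWeightedHarmonic 0 h := by
  constructor
  · refine fun hh => ⟨hh.contDiffOn, fun x hx => ?_⟩
    rw [(hh x hx).2.self_of_nhds]
    simp
  · refine fun hh x hx => ⟨hh.1.contDiffAt (isOpen_ball.mem_nhds hx), ?_⟩
    filter_upwards [isOpen_ball.mem_nhds hx] with y hy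
    have hequation := hh.2 y hy
    rw [mul_zero, zero_mul, add_zero] at hequation
    exact (mul_eq_zero.1 hequation).resolve_left (one_sub_norm_sq_pos hy).ne'

theorem isHyperbolicHarmonic_iff_isWeightedHarmonic {h : EuclideanSpace ℝ (Fin n) → ℝ} :
    IsHyperbolicHarmonic h ↔ IsWeightedHarmonic (n - 2) h := by
  refine and_congr Iff.rfl (forall₂_congr fun x hx => ?_)
  have hfactor : hyperbolicLaplacian h x = (1 - ‖x‖ ^ 2) *
      ((1 - ‖x‖ ^ 2) * Laplacian.laplacian h x + 2 * (n - 2) * fderiv ℝ h x x) := by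
    rw [hyperbolicLaplacian, sum_mul_fderiv_single]
    ring
  rw [hfactor, mul_eq_zero, or_iff_right (one_sub_norm_sq_pos hx).ne']

end EuclideanSpace

theorem mainTheorem4 (n : ℕ) (hn : 3 ≤ n) :
    -- harmonic functions: the estimate, its strictness for `n ≥ 4`, and its sharpness
    ((∀ h : EuclideanSpace ℝ (Fin n) → ℝ, IsHarmonic h →
        Set.MapsTo h (unitBall n) (Set.Ioo (-1) 1) →
          ‖gradient h 0‖ ≤ (n : ℝ) / 2 * (1 - |h 0| ^ 2) ∧
          (4 ≤ n → ‖gradient h 0‖ < (n : ℝ) / 2 * (1 - |h 0| ^ 2))) ∧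
      (∀ c : ℝ, c < (n : ℝ) / 2 → ∃ h : EuclideanSpace ℝ (Fin n) → ℝ, IsHarmonic h ∧
        Set.MapsTo h (unitBall n) (Set.Ioo (-1) 1) ∧
          c * (1 - |h 0| ^ 2) < ‖gradient h 0‖)) ∧
    -- hyperbolic harmonic functions: the estimate, its strictness for `n ≥ 4`, and its sharpness
    ((∀ h : EuclideanSpace ℝ (Fin n) → ℝ, IsHyperbolicHarmonic h →
        Set.MapsTo h (unitBall n) (Set.Ioo (-1) 1) →
          ‖gradient h 0‖ ≤ ((n : ℝ) - 1) * (1 - |h 0| ^ 2) ∧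
          (4 ≤ n → ‖gradient h 0‖ < ((n : ℝ) - 1) * (1 - |h 0| ^ 2))) ∧
      (∀ c : ℝ, c < (n : ℝ) - 1 → ∃ h : EuclideanSpace ℝ (Fin n) → ℝ, IsHyperbolicHarmonic h ∧
        Set.MapsTo h (unitBall n) (Set.Ioo (-1) 1) ∧
          c * (1 - |h 0| ^ 2) < ‖gradient h 0‖)) := by
  simpa only [isHarmonic_iff_isWeightedHarmonic, isHyperbolicHarmonic_iff_isWeightedHarmonic,
    finrank_euclideanSpace_fin, unitBall] using
    mainTheorem4_general (E := EuclideanSpace ℝ (Fin n)) (by simpa using hn)
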